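/- Let $m\ge 1$ and consider $m$ sources of updates. For $n\ge1$ let $(T_n^1,\dots,T_n^m)$ be i.i.d. random vectors with an arbitrary joint distribution, distributed like $(T^1,\dots,T^m)$, and for each $i$ let $Y^i_1,Y^i_2,\dots$ be i.i.d. almost surely positive random variables, distributed like $Y^i$; assume that the vectors $(T_n^1,\dots,T_n^m)$, $n\ge1$, and the variables $Y_j^i$, $1\le i\le m$, $j\ge1$, are all independent. Assume that each $T^i$ is almost surely nonnegative, has a nonarithmetic distribution (it is not concentrated on $d\mathbb Z$ for any $d>0$) and a mean $\mu_i=ET^i\in(0,\infty)$, and that $\mu_i\ne\mu_j$ for $i\neq j$. Let $c_1,\dots,c_m>0$. Put $S_n^i=\sum_{k=1}^nT_k^i$ (so $S_0^i=0$), $N^i(t)=\sup\{n\ge 0: S_n^i\le t\}$ and $\beta_i(t)=t-S^i_{N^i(t)}$ (the age process); the $n$th update of source $i$ is generated at time $S_n^i$, has size $Y_n^i$, and is sent over a channel of capacity $c_i$. The system is said to be updated at time $t>0$ if $\beta_i(t)>Y^i_{N^i(t)}/c_i$ for every $i=1,\dots,m$, where for a source with $N^i(t)=0$ (no update so far) this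 condition is replaced by an arbitrary event $A_i(t)$ prescribing its initial status. Let $$\bar F_e^i(x)=1-F_e^i(x),\qquad F_e^i(x)=\frac1{\mu_i}\int_0^xP(T^i>s)\,ds\quad(x\ge0)$$ be the tail of the stationary-excess (equilibrium) distribution of $T^i$. Then, whatever the events $A_i(t)$ are, the limiting probability that the system is updated exists and equals $$\pi=\lim_{t\to\infty}P(\text{the system is updated at time }t)=\prod_{i=1}^mE\,\bar F_e^i\!\left(\frac{Y^i}{c_i}\right).$$ -/

import Mathlib

open MeasureTheory ProbabilityTheory Filter Topology

noncomputable section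

namespace StatusUpdating

variable {Ω : Type*} {m : ℕ}

/-- A law on `ℝ` is nonarithmetic if it is not concentrated on a lattice `dℤ` with `d > 0`. -/
def Nonarithmetic (ν : Measure ℝ) : Prop :=
  ∀ d : ℝ, 0 < d → ¬ ∀ᵐ x ∂ν, ∃ k : ℤ, x = k * d

/-- The stationary-excess (equilibrium) distribution function
`F_e(x) = μ⁻¹ ∫₀ˣ P(T > s) ds` (which is `0` for `x ≤ 0`) of a law `ν` of `T`
with mean `μ`. -/
def equilibriumCDF (ν : Measure ℝ) (x : ℝ) : ℝ :=
  (∫ y, y ∂ν)⁻¹ * ∫ s in Set.Ioc 0 x, ν.real (Set.Ioi s)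

/-- The tail `1 - F_e`. -/
def equilibriumTail (ν : Measure ℝ) (x : ℝ) : ℝ :=
  1 - equilibriumCDF ν x

/-- Renewal epochs `S_n^i = T_1^i + ⋯ + T_n^i`, with `S_0^i = 0`.
Indices start from zero: `T k ω i` is the `(k+1)`-st inter-update time of source `i`. -/
def epoch (T : ℕ → Ω → Fin m → ℝ) (i : Fin m) (n : ℕ) (ω : Ω) : ℝ :=
  ∑ k ∈ Finset.range n, T k ω i

/-- The counting process `N^i(t) = sup {n | S_n^i ≤ t}`. -/
def count (T : ℕ → Ω → Fin m → ℝ) (i : Fin m) (t : ℝ) (ω : Ω) : ℕ :=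
  sSup {n : ℕ | epoch T i n ω ≤ t}

/-- The age process `β_i(t) = t - S^i_{N^i(t)}`. -/
def age (T : ℕ → Ω → Fin m → ℝ) (i : Fin m) (t : ℝ) (ω : Ω) : ℝ :=
  t - epoch T i (count T i t ω) ω

/-- Source `i` is up to date at time `t`. If the most recent update is the `(n+1)`-st one,
of size `Y i n`, this means that its age is larger than its transmission time
`Y i n / c i`. Before the first update the status is given by the event `init i t`. -/
def SourceUpdated (T : ℕ → Ω → Fin m → ℝ) (Y : Fin m → ℕ → Ω → ℝ) (c : Fin m → ℝ)
    (init : Fin m → ℝ → Set Ω) (i : Fin m) (t : ℝ) (ω : Ω) : Prop :=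
  match count T i t ω with
  | 0 => ω ∈ init i t
  | n + 1 => Y i n ω / c i < age T i t ω

/-- The event that the system is updated at time `t`: every source is up to date. -/
def systemUpdated (T : ℕ → Ω → Fin m → ℝ) (Y : Fin m → ℕ → Ω → ℝ) (c : Fin m → ℝ)
    (init : Fin m → ℝ → Set Ω) (t : ℝ) : Set Ω :=
  {ω | ∀ i, SourceUpdated T Y c init i t ω}

/-- The σ-algebras generated by the random vectors `T n` (one for each `n`) and by the
random variables `Y i j` (one for each pair `(i, j)`). -/
@[reducible] def generatedSigma (T : ℕ → Ω → Fin m → ℝ) (Y : Fin m → ℕ → Ω → ℝ) :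
    ℕ ⊕ (Fin m × ℕ) → MeasurableSpace Ω
  | Sum.inl n => MeasurableSpace.comap (T n) inferInstance
  | Sum.inr p => MeasurableSpace.comap (Y p.1 p.2) inferInstance

end StatusUpdating

end

/-! ### The renewal equation with a nonarithmetic law -/

noncomputable section

namespace StatusUpdating

/-! By the law of large numbers source `i` has made about `t / μ_i` updates by time `t`. Since the
means differ, the sources look at well separated stretches of the sequence of vectors `T n`, and
this decouples them however dependent the coordinates of one vector are. Sources are added in order
of decreasing mean. If `j` has the smallest mean so far, choose `a` with `1 / μ_i < a < 1 / μ_j` for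
all earlier `i`. Almost surely, for large `t`, the earlier sources have not reached epoch number `⌊a
t⌋ + 1`, so their status depends only on variables before that epoch. Source `j` passed it long ago
and has since been running on fresh variables for a time that tends to infinity. Given the past, it
is up to date with a probability close to its own limit, which therefore factors out
(`measureReal_inter_updatedIn_Ici`, `tendsto_updatedIn_insert`). The initial events matter only
before the first update and drop out.

For a single source, the size of the current update is independent of the inter-update times, so the
limit is an average over sizes of the limiting age tail. The age tail solves a renewal equation
whose inhomogeneous term has integral `μ (1 - F_e(v))`. The key renewal theorem is proved for
bounded uniformly continuous solutions (`tendsto_of_renewal_equation`): where such a solution is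
near its limsup, so are its translates by sums of support points, and for a nonarithmetic law these
sums are eventually nearly dense. The integrated equation then gives the value of the limsup, and
the same argument for `-W` that of the liminf. The age tail may jump, so the theorem is applied to
averages over short windows (`tendsto_average_ageTail`), and monotonicity removes the averaging
(`tendsto_ageTail`). -/

/-- An additive monoid of nonnegative reals that generates a dense group comes close to every
sufficiently large real number. -/
theorem exists_mem_addSubmonoid_near (S : AddSubmonoid ℝ) (hS : ∀ s ∈ S, 0 ≤ s)
    (hd : Dense (AddSubgroup.closure (S : Set ℝ) : Set ℝ)) {ε : ℝ} (hε : 0 < ε) :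
    ∃ A : ℝ, ∀ x ≥ A, ∃ s ∈ S, |x - s| ≤ ε := by
  obtain ⟨e, he, he0, heε⟩ := hd.exists_between hε
  have hdiff : ∀ x ∈ AddSubgroup.closure (S : Set ℝ), ∃ a ∈ S, ∃ b ∈ S, x = a - b := by
    intro x hx
    induction hx using AddSubgroup.closure_induction with
    | mem x hx => exact ⟨x, hx, 0, S.zero_mem, by simp⟩
    | zero => exact ⟨0, S.zero_mem, 0, S.zero_mem, by simp⟩
    | add x y _ _ hx hy =>
      obtain ⟨a, ha, b, hb, rfl⟩ := hx
      obtain ⟨a', ha', b', hb', rfl⟩ := hy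
      exact ⟨a + a', S.add_mem ha ha', b + b', S.add_mem hb hb', by ring⟩
    | neg x _ hx =>
      obtain ⟨a, ha, b, hb, rfl⟩ := hx
      exact ⟨b, hb, a, ha, by ring⟩
  obtain ⟨a₀, ha₀, b₀, hb₀, hab₀⟩ := hdiff e he
  -- Adding `a₀ = b₀ + e > 0` to both terms keeps the difference `e` and makes `b` positive, so that
  -- one may divide by it.
  obtain ⟨a, ha, b, hb, hab, hb0⟩ : ∃ a ∈ S, ∃ b ∈ S, e = a - b ∧ 0 < b :=
    ⟨a₀ + a₀, S.add_mem ha₀ ha₀, b₀ + a₀, S.add_mem hb₀ ha₀, by linarith,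
      by linarith [hS b₀ hb₀]⟩
  obtain ⟨n₀, hn₀⟩ := exists_nat_ge (b / e)
  refine ⟨n₀ * b, fun x hx ↦ ?_⟩
  have hx0 : 0 ≤ x / b := div_nonneg (le_trans (by positivity) hx) hb0.le
  set n := ⌊x / b⌋₊ with hn
  have hn1 : n * b ≤ x := (le_div_iff₀ hb0).1 (Nat.floor_le hx0)
  have hn2 : x < (n + 1) * b := (div_lt_iff₀ hb0).1 (Nat.lt_floor_add_one _)
  have hnn : n₀ ≤ n := Nat.le_floor ((le_div_iff₀ hb0).2 hx)
  have hy0 : 0 ≤ (x - n * b) / e := div_nonneg (by linarith) he0.le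
  set k := ⌊(x - n * b) / e⌋₊ with hk
  have hk1 : k * e ≤ x - n * b := (le_div_iff₀ he0).1 (Nat.floor_le hy0)
  have hk2 : x - n * b < (k + 1) * e := (div_lt_iff₀ he0).1 (Nat.lt_floor_add_one _)
  -- The remainder `x - n b` is less than `b ≤ n₀ e`, so at most `n₀ ≤ n` steps of length `e` are
  -- needed.
  have hkn : k ≤ n := by
    have h1 : (k : ℝ) * e ≤ n₀ * e := by
      have := (div_le_iff₀ he0).1 hn₀
      linarith
    exact (Nat.cast_le.1 (le_of_mul_le_mul_right h1 he0)).trans hnn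
  -- Trading `k` of the `n` copies of `b` for `a = b + e` moves `n b` up by `k e`, to within `e` of
  -- `x`.
  refine ⟨(n - k) • b + k • a, S.add_mem (S.nsmul_mem hb _) (S.nsmul_mem ha _), ?_⟩
  have : ((n - k : ℕ) : ℝ) = n - k := by push_cast [hkn]; ring
  rw [nsmul_eq_mul, nsmul_eq_mul, this, abs_le]
  have ha' : a = b + e := by linarith
  subst ha'
  constructor <;> nlinarith

/-- A subgroup of `ℝ` that is not dense is cyclic, and the support has full measure, so `ν` would
live on a lattice. A zero generator means mass at `0` only, which lies in `ℤ`. -/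
theorem Nonarithmetic.dense_closure_support {ν : Measure ℝ} (h : Nonarithmetic ν) :
    Dense (AddSubgroup.closure ν.support : Set ℝ) := by
  refine (AddSubgroup.dense_or_cyclic _).resolve_right ?_
  rintro ⟨a, ha⟩
  have key : ∀ x ∈ ν.support, ∃ k : ℤ, k • a = x := fun x hx ↦ by
    have : x ∈ AddSubgroup.closure ν.support := AddSubgroup.subset_closure hx
    rwa [ha, AddSubgroup.mem_closure_singleton] at this
  by_cases ha0 : a = 0
  · refine h 1 one_pos ?_
    filter_upwards [Measure.support_mem_ae] with x hx
    obtain ⟨k, rfl⟩ := key x hx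
    exact ⟨0, by simp [ha0]⟩
  · refine h |a| (abs_pos.2 ha0) ?_
    filter_upwards [Measure.support_mem_ae] with x hx
    obtain ⟨k, rfl⟩ := key x hx
    rcases abs_choice a with h | h
    · exact ⟨k, by rw [h]; simp⟩
    · exact ⟨-k, by rw [h]; simp⟩

theorem integral_tail {ν : Measure ℝ} (hν : ∀ᵐ y ∂ν, 0 ≤ y) (hint : Integrable (fun y ↦ y) ν) :
    ∫ s in Set.Ioi 0, ν.real (Set.Ioi s) = ∫ y, y ∂ν :=
  (hint.integral_eq_integral_meas_lt hν).symm

section KeyRenewal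

variable {ν : Measure ℝ} [IsProbabilityMeasure ν] {W h : ℝ → ℝ} {K M a : ℝ}

theorem integrable_comp_sub (hWm : Measurable W) (hK : ∀ t, |W t| ≤ K) (t : ℝ) :
    Integrable (fun y ↦ W (t - y)) ν :=
  .of_bound (hWm.comp (measurable_const.sub measurable_id)).aestronglyMeasurable K
    (.of_forall fun _ ↦ hK _)

/-- If a solution of the renewal equation approaches its limit superior along `τ`, then it also
does so along `τ - y`, for every point `y` of the support. -/
theorem tendsto_sub_of_mem_support (hWm : UniformContinuous W) (hK : ∀ t, |W t| ≤ K)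
    (hren : ∀ t, W t = h t + ∫ y, W (t - y) ∂ν) (hh : Tendsto h atTop (𝓝 0))
    (hup : ∀ ε > 0, ∀ᶠ t in atTop, W t ≤ M + ε)
    {ι : Type*} {l : Filter ι} [l.IsCountablyGenerated] {τ : ι → ℝ} (hτ : Tendsto τ l atTop)
    (hM : Tendsto (fun i ↦ W (τ i)) l (𝓝 M)) {y : ℝ} (hy : y ∈ ν.support) :
    Tendsto (fun i ↦ W (τ i - y)) l (𝓝 M) := by
  have hmeas : Measurable W := hWm.continuous.measurable
  have hint (i : ι) : Integrable (fun y ↦ W (τ i - y) - M) ν :=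
    (integrable_comp_sub hmeas hK _).sub (integrable_const _)
  have h1 : Tendsto (fun i ↦ ∫ y, (W (τ i - y) - M) ∂ν) l (𝓝 0) := by
    have : ∀ i, ∫ y, (W (τ i - y) - M) ∂ν = W (τ i) - h (τ i) - M := fun i ↦ by
      rw [integral_sub (integrable_comp_sub hmeas hK _) (integrable_const _), hren (τ i)]
      simp
    simp_rw [this]
    simpa using (hM.sub (hh.comp hτ)).sub_const M
  have h2 : Tendsto (fun i ↦ ∫ y, max (W (τ i - y) - M) 0 ∂ν) l (𝓝 (∫ _, (0 : ℝ) ∂ν)) := by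
    refine tendsto_integral_filter_of_dominated_convergence (fun _ ↦ K + |M|)
      (.of_forall fun i ↦ ((hint i).1.sup aestronglyMeasurable_const)) ?_
      (integrable_const _) ?_
    · refine .of_forall fun i ↦ .of_forall fun y ↦ ?_
      have := hK (τ i - y)
      rw [Real.norm_eq_abs, abs_of_nonneg (le_max_right _ _)]
      refine max_le ?_ (add_nonneg ((abs_nonneg _).trans this) (abs_nonneg _))
      linarith [le_abs_self (W (τ i - y)), neg_abs_le M]
    · refine .of_forall fun y ↦ ?_
      rw [Metric.tendsto_nhds]
      intro ε hε
      have hτy : Tendsto (fun i ↦ τ i - y) l atTop := tendsto_atTop_add_const_right _ _ hτ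
      filter_upwards [hτy.eventually (hup (ε / 2) (half_pos hε))] with i hi
      rw [Real.dist_0_eq_abs, abs_of_nonneg (le_max_right _ _)]
      exact max_lt (by linarith) hε
  -- Convergence in `L¹(ν)`, from `|f| = 2 max(f, 0) - f`: the positive part vanishes by the limsup
  -- bound, the integral of `f` by the renewal equation.
  have h3 : Tendsto (fun i ↦ ∫ y, |W (τ i - y) - M| ∂ν) l (𝓝 0) := by
    have : ∀ i, ∫ y, |W (τ i - y) - M| ∂ν
        = 2 * (∫ y, max (W (τ i - y) - M) 0 ∂ν) - ∫ y, (W (τ i - y) - M) ∂ν := fun i ↦ by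
      rw [← integral_const_mul, ← integral_sub ((hint i).pos_part.const_mul 2) (hint i)]
      congr with y
      rcases le_total 0 (W (τ i - y) - M) with h | h
      · rw [abs_of_nonneg h, max_eq_left h]; ring
      · rw [abs_of_nonpos h, max_eq_right h]; ring
    simp_rw [this]
    simpa using (h2.const_mul 2).sub h1
  rw [Metric.tendsto_nhds]
  intro ε hε
  obtain ⟨δ, hδ, hWδ⟩ := Metric.uniformContinuous_iff.1 hWm (ε / 2) (half_pos hε)
  have hb : 0 < ν.real (Metric.ball y δ) :=
    ENNReal.toReal_pos ((Measure.mem_support_iff_forall y).1 hy _ (Metric.ball_mem_nhds y hδ)).ne'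
      (measure_ne_top _ _)
  -- Markov's inequality: a deviation of at least `ε` at `y` would persist, as at least `ε / 2`, on
  -- a ball around `y` of positive mass.
  filter_upwards [h3.eventually_lt_const (mul_pos (half_pos hε) hb)] with i hi
  by_contra! hcon
  rw [Real.dist_eq] at hcon
  have hsub : Metric.ball y δ ⊆ {y' | ε / 2 ≤ |W (τ i - y') - M|} := fun y' hy' ↦ by
    have : dist (τ i - y') (τ i - y) < δ := by
      rw [Metric.mem_ball, Real.dist_eq] at hy'
      rw [Real.dist_eq, ← abs_neg]
      simpa using hy'
    have h4 := hWδ this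
    rw [Real.dist_eq] at h4
    have h5 := abs_sub_abs_le_abs_sub (W (τ i - y) - M) (W (τ i - y') - M)
    have h6 : W (τ i - y) - M - (W (τ i - y') - M) = -(W (τ i - y') - W (τ i - y)) := by ring
    rw [h6, abs_neg] at h5
    simp only [Set.mem_ofPred_eq]
    linarith
  have h7 := mul_meas_ge_le_integral_of_nonneg (.of_forall fun y ↦ abs_nonneg _) (hint i).abs (ε / 2)
  have h8 := mul_le_mul_of_nonneg_left (measureReal_mono hsub (μ := ν)) (half_pos hε).le
  linarith

theorem integral_comp_sub_Iic (f : ℝ → ℝ) (τ y : ℝ) :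
    ∫ u in Set.Iic τ, f (u - y) = ∫ u in Set.Iic (τ - y), f u := by
  rw [← integral_indicator measurableSet_Iic, ← integral_indicator measurableSet_Iic,
    ← integral_sub_right_eq_self (fun u ↦ (Set.Iic (τ - y)).indicator f u) y]
  congr with u
  simp [Set.indicator_apply]

theorem integrableOn_Iic_of_bounded (hWm : Measurable W) (hK : ∀ t, |W t| ≤ K)
    (ha : ∀ t < a, W t = 0) (τ : ℝ) : IntegrableOn W (Set.Iic τ) := by
  have h1 : IntegrableOn W (Set.Icc a τ) :=
    Measure.integrableOn_of_bounded (M := K) (by simp) hWm.aestronglyMeasurable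
      (.of_forall fun t ↦ hK t)
  have h2 : IntegrableOn W (Set.Iio a) :=
    integrableOn_zero.congr_fun (fun t ht ↦ (ha t ht).symm) measurableSet_Iio
  refine (h1.union h2).mono_set fun t ht ↦ ?_
  rcases lt_or_ge t a with h | h
  · exact .inr h
  · exact .inl ⟨h, ht⟩

/-- Integrated form of the renewal equation `W = h + ν ∗ W`. -/
theorem integral_tail_mul_eq (hWm : Measurable W) (hK : ∀ t, |W t| ≤ K)
    (ha : ∀ t < a, W t = 0) (hren : ∀ t, W t = h t + ∫ y, W (t - y) ∂ν)
    (hν : ∀ᵐ y ∂ν, 0 ≤ y) (τ : ℝ) :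
    ∫ s in Set.Ioi 0, ν.real (Set.Ioi s) * W (τ - s) = ∫ u in Set.Iic τ, h u := by
  have hWi := integrableOn_Iic_of_bounded hWm hK ha
  have hK0 : 0 ≤ K := (abs_nonneg _).trans (hK 0)
  -- Since `y ≥ 0` almost surely, `W (u - y)` vanishes for `u < a`; hence a constant on `[a, τ]`
  -- dominates and Fubini applies.
  have hbd : Integrable (fun z : ℝ × ℝ ↦ (Set.Icc a τ).indicator (fun _ ↦ K) z.1)
      ((volume.restrict (Set.Iic τ)).prod ν) := by
    have : Integrable ((Set.Icc a τ).indicator (fun _ ↦ K)) (volume.restrict (Set.Iic τ)) :=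
      (integrable_indicator_iff measurableSet_Icc).2
        (integrableOn_const (by rw [Measure.restrict_apply measurableSet_Icc]
                                exact ((measure_mono Set.inter_subset_left).trans_lt (by simp)).ne))
    simpa using this.mul_prod (integrable_const (μ := ν) (1 : ℝ))
  have hI1 : Integrable (fun z : ℝ × ℝ ↦ W (z.1 - z.2)) ((volume.restrict (Set.Iic τ)).prod ν) := by
    refine hbd.mono' (hWm.comp (measurable_fst.sub measurable_snd)).aestronglyMeasurable ?_
    have h1 : ∀ᵐ z ∂((volume.restrict (Set.Iic τ)).prod ν), 0 ≤ z.2 :=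
      Measure.quasiMeasurePreserving_snd.ae hν
    have h2 : ∀ᵐ z ∂((volume.restrict (Set.Iic τ)).prod ν), z.1 ≤ τ :=
      Measure.quasiMeasurePreserving_fst.ae (ae_restrict_mem measurableSet_Iic)
    filter_upwards [h1, h2] with z hz1 hz2
    by_cases hz : a ≤ z.1
    · rw [Set.indicator_of_mem (show z.1 ∈ Set.Icc a τ from ⟨hz, hz2⟩)]
      exact hK _
    · rw [ha (z.1 - z.2) (by linarith), norm_zero]
      exact Set.indicator_nonneg (fun _ _ ↦ hK0) _
  have hbd2 : Integrable (fun z : ℝ × ℝ ↦ (Set.Ioc 0 (τ - a)).indicator (fun _ ↦ K) z.1)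
      ((volume.restrict (Set.Ioi 0)).prod ν) := by
    have : Integrable ((Set.Ioc 0 (τ - a)).indicator (fun _ ↦ K)) (volume.restrict (Set.Ioi 0)) :=
      (integrable_indicator_iff measurableSet_Ioc).2
        (integrableOn_const (by rw [Measure.restrict_apply measurableSet_Ioc]
                                exact ((measure_mono Set.inter_subset_left).trans_lt (by simp)).ne))
    simpa using this.mul_prod (integrable_const (μ := ν) (1 : ℝ))
  have hms : MeasurableSet {z : ℝ × ℝ | z.1 < z.2} := measurableSet_lt measurable_fst measurable_snd
  have hI2 : Integrable (fun z : ℝ × ℝ ↦ {z : ℝ × ℝ | z.1 < z.2}.indicator (fun z ↦ W (τ - z.1)) z)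
      ((volume.restrict (Set.Ioi 0)).prod ν) := by
    refine hbd2.mono' (((hWm.comp (measurable_const.sub measurable_fst)).indicator
      hms)).aestronglyMeasurable ?_
    have h2 : ∀ᵐ z ∂((volume.restrict (Set.Ioi (0 : ℝ))).prod ν), 0 < z.1 :=
      Measure.quasiMeasurePreserving_fst.ae (ae_restrict_mem measurableSet_Ioi)
    filter_upwards [h2] with z hz2
    refine (norm_indicator_le_norm_self _ _).trans ?_
    by_cases hz : z.1 ≤ τ - a
    · rw [Set.indicator_of_mem (show z.1 ∈ Set.Ioc 0 (τ - a) from ⟨hz2, hz⟩)]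
      exact hK _
    · rw [ha (τ - z.1) (by linarith), norm_zero]
      exact Set.indicator_nonneg (fun _ _ ↦ hK0) _
  -- Both sides become the `ν`-average of the integral of `W` over `[τ - y, τ]`; on the left,
  -- `ν.real (Set.Ioi s)` is written as the `ν`-integral of the indicator of `s < y`.
  have hR : ∫ u in Set.Iic τ, h u
      = (∫ u in Set.Iic τ, W u) - ∫ y, (∫ u in Set.Iic (τ - y), W u) ∂ν := by
    have h1 : ∀ u, h u = W u - ∫ y, W (u - y) ∂ν := fun u ↦ by rw [hren u]; ring
    simp_rw [h1]
    rw [integral_sub (hWi τ) hI1.integral_prod_left, integral_integral_swap hI1]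
    simp_rw [integral_comp_sub_Iic]
  have hFi : Integrable (fun y ↦ ∫ u in Set.Iic (τ - y), W u) ν := by
    have := hI1.integral_prod_right
    simpa only [integral_comp_sub_Iic] using this
  rw [hR]
  have h3 : ∀ s, ν.real (Set.Ioi s) * W (τ - s)
      = ∫ y, {z : ℝ × ℝ | z.1 < z.2}.indicator (fun z ↦ W (τ - z.1)) (s, y) ∂ν := fun s ↦ by
    have : (fun y ↦ {z : ℝ × ℝ | z.1 < z.2}.indicator (fun z ↦ W (τ - z.1)) (s, y))
        = (Set.Ioi s).indicator (fun _ ↦ W (τ - s)) := by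
      ext y
      simp [Set.indicator_apply]
    rw [this, integral_indicator measurableSet_Ioi, setIntegral_const, smul_eq_mul]
  simp_rw [h3]
  rw [integral_integral_swap hI2]
  have h4 : ∫ y, (∫ u in Set.Iic τ, W u) - (∫ u in Set.Iic (τ - y), W u) ∂ν
      = (∫ u in Set.Iic τ, W u) - ∫ y, (∫ u in Set.Iic (τ - y), W u) ∂ν := by
    rw [integral_sub (integrable_const _) hFi]
    simp
  rw [← h4]
  refine integral_congr_ae ?_
  filter_upwards [hν] with y hy
  have : ∀ s : ℝ, {z : ℝ × ℝ | z.1 < z.2}.indicator (fun z ↦ W (τ - z.1)) (s, y)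
      = (Set.Iio y).indicator (fun s ↦ W (τ - s)) s := fun s ↦ by
    simp [Set.indicator_apply]
  simp_rw [this]
  rw [integral_indicator measurableSet_Iio, Measure.restrict_restrict measurableSet_Iio,
    Set.inter_comm, Set.Ioi_inter_Iio, ← integral_Ioc_eq_integral_Ioo,
    ← intervalIntegral.integral_of_le hy, intervalIntegral.integral_comp_sub_left (fun u ↦ W u) τ,
    ← intervalIntegral.integral_Iic_sub_Iic (hWi _) (hWi _), sub_zero]

theorem integrableOn_tail (hν : ∀ᵐ y ∂ν, 0 ≤ y) (hint : Integrable (fun y ↦ y) ν) :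
    IntegrableOn (fun s ↦ ν.real (Set.Ioi s)) (Set.Ioi 0) := by
  have hanti : Antitone fun s ↦ ν.real (Set.Ioi s) :=
    fun s t hst ↦ measureReal_mono (Set.Ioi_subset_Ioi hst)
  refine ⟨hanti.measurable.aestronglyMeasurable, ?_⟩
  have h1 := lintegral_eq_lintegral_meas_lt ν hν hint.aemeasurable
  rw [hasFiniteIntegral_iff_ofReal (.of_forall fun _ ↦ measureReal_nonneg)]
  have h2 : ∀ s, ENNReal.ofReal (ν.real (Set.Ioi s)) = ν {y | s < y} := fun s ↦
    ofReal_measureReal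
  simp_rw [h2]
  rw [← h1]
  exact ((hasFiniteIntegral_iff_ofReal hν).1 hint.2)

theorem tendsto_sub_of_mem_closure_support (hWm : UniformContinuous W) (hK : ∀ t, |W t| ≤ K)
    (hren : ∀ t, W t = h t + ∫ y, W (t - y) ∂ν) (hh : Tendsto h atTop (𝓝 0))
    (hup : ∀ ε > 0, ∀ᶠ t in atTop, W t ≤ M + ε)
    {l : Filter ℝ} [l.IsCountablyGenerated] (hl : l ≤ atTop)
    (hM : Tendsto W l (𝓝 M)) {s : ℝ} (hs : s ∈ AddSubmonoid.closure ν.support) :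
    Tendsto (fun t ↦ W (t - s)) l (𝓝 M) := by
  -- The path is arbitrary because the induction treats `x + y` by applying the claim for `y` along
  -- `τ - x`.
  suffices ∀ τ : ℝ → ℝ, Tendsto τ l atTop → Tendsto (fun t ↦ W (τ t)) l (𝓝 M) →
      Tendsto (fun t ↦ W (τ t - s)) l (𝓝 M) from this id hl hM
  induction hs using AddSubmonoid.closure_induction with
  | mem x hx => exact fun τ hτ hτM ↦ tendsto_sub_of_mem_support hWm hK hren hh hup hτ hτM hx
  | zero => intro τ _ hτM; simpa using hτM
  | add x y _ _ hx hy =>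
    intro τ hτ hτM
    simpa [sub_sub] using hy (fun t ↦ τ t - x) (tendsto_atTop_add_const_right _ _ hτ) (hx τ hτ hτM)

/-- The upper limit of a solution of the renewal equation is determined by the integral of the
inhomogeneous term. -/
theorem eq_mul_mean_of_tendsto (hWu : UniformContinuous W) (hK : ∀ t, |W t| ≤ K)
    (ha : ∀ t < a, W t = 0) (hren : ∀ t, W t = h t + ∫ y, W (t - y) ∂ν)
    (hν : ∀ᵐ y ∂ν, 0 ≤ y) (hint : Integrable (fun y ↦ y) ν) (hna : Nonarithmetic ν)
    (hh : Tendsto h atTop (𝓝 0)) {H : ℝ}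
    (hH : Tendsto (fun τ ↦ ∫ u in Set.Iic τ, h u) atTop (𝓝 H))
    (hup : ∀ ε > 0, ∀ᶠ t in atTop, W t ≤ M + ε)
    {l : Filter ℝ} [l.IsCountablyGenerated] [l.NeBot] (hl : l ≤ atTop) (hM : Tendsto W l (𝓝 M)) :
    H = M * ∫ y, y ∂ν := by
  have hm : Measurable W := hWu.continuous.measurable
  have hGi := integrableOn_tail hν hint
  have hsupp : ∀ s ∈ AddSubmonoid.closure ν.support, 0 ≤ s := by
    have h0 : ν.support ⊆ Set.Ici 0 := Measure.support_subset_of_isClosed isClosed_Ici hν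
    intro s hs
    induction hs using AddSubmonoid.closure_induction with
    | mem x hx => exact h0 hx
    | zero => exact le_rfl
    | add x y _ _ hx hy => exact add_nonneg hx hy
  have hdense : Dense (AddSubgroup.closure (AddSubmonoid.closure ν.support : Set ℝ) : Set ℝ) :=
    hna.dense_closure_support.mono
      (AddSubgroup.closure_mono (AddSubmonoid.subset_closure))
  suffices ∀ ε > 0, |H - M * ∫ y, y ∂ν| ≤ 2 * ε * ∫ y, y ∂ν by
    have h1 : Tendsto (fun ε : ℝ ↦ 2 * ε * ∫ y, y ∂ν) (𝓝[>] 0) (𝓝 0) := by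
      have : Continuous fun ε : ℝ ↦ 2 * ε * ∫ y, y ∂ν := by fun_prop
      simpa using (this.tendsto 0).mono_left nhdsWithin_le_nhds
    have h2 := ge_of_tendsto h1 (eventually_mem_nhdsWithin.mono this)
    exact sub_eq_zero.1 (abs_nonpos_iff.1 h2)
  intro ε hε
  obtain ⟨δ, hδ, hWδ⟩ := Metric.uniformContinuous_iff.1 hWu ε hε
  obtain ⟨A, hA⟩ := exists_mem_addSubmonoid_near _ hsupp hdense (half_pos hδ)
  have hnear : ∀ u ≥ A, ∀ᶠ t in l, |W (t - u) - M| ≤ 2 * ε := by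
    intro u hu
    obtain ⟨s, hs, hus⟩ := hA u hu
    have h1 := tendsto_sub_of_mem_closure_support hWu hK hren hh hup hl hM hs
    filter_upwards [Metric.tendsto_nhds.1 h1 ε hε] with t ht
    have h2 : dist (t - u) (t - s) < δ := by
      rw [Real.dist_eq, show t - u - (t - s) = -(u - s) by ring, abs_neg]
      linarith
    have h3 := hWδ h2
    have h4 := dist_triangle (W (t - u)) (W (t - s)) M
    rw [Real.dist_eq (W (t - u)) M] at h4
    linarith
  have hGW (t : ℝ) : IntegrableOn (fun s ↦ ν.real (Set.Ioi s) * W (t - s)) (Set.Ioi 0) :=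
    Integrable.mul_bdd (c := K) hGi (hm.comp (measurable_const.sub measurable_id)).aestronglyMeasurable
      (.of_forall fun s ↦ hK _)
  have hGd (t : ℝ) : IntegrableOn (fun s ↦ ν.real (Set.Ioi s) * |W (t - s) - M|) (Set.Ioi 0) :=
    Integrable.mul_bdd (c := K + |M|) hGi
      ((hm.comp (measurable_const.sub measurable_id)).sub_const M).abs.aestronglyMeasurable
      (.of_forall fun s ↦ by
        rw [Real.norm_eq_abs, abs_abs]
        exact (abs_sub _ _).trans (add_le_add_left (hK _) _))
  -- Shifting by `A` makes every `s > 0` correspond to a lag `A + s ≥ A`, where `hnear` applies.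
  have h1 : Tendsto (fun t ↦ ∫ s in Set.Ioi 0, ν.real (Set.Ioi s) * W (t - A - s)) l (𝓝 H) := by
    simp_rw [integral_tail_mul_eq hm hK ha hren hν]
    exact (hH.comp (tendsto_atTop_add_const_right _ (-A) tendsto_id)).mono_left hl
  -- `hnear` is not uniform in the lag, so the excess over `2ε` is removed by dominated convergence.
  have h2 : Tendsto (fun t ↦ ∫ s in Set.Ioi 0,
      ν.real (Set.Ioi s) * max (|W (t - A - s) - M| - 2 * ε) 0) l
      (𝓝 (∫ _ in Set.Ioi (0 : ℝ), (0 : ℝ))) := by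
    refine tendsto_integral_filter_of_dominated_convergence
      (fun s ↦ ν.real (Set.Ioi s) * (K + |M|)) (.of_forall fun t ↦ ?_) (.of_forall fun t ↦ ?_)
      (hGi.mul_const _) ?_
    · exact hGi.1.mul ((((hm.comp (measurable_const.sub measurable_id)).sub_const M).abs.sub_const
        _).max measurable_const).aestronglyMeasurable
    · refine .of_forall fun s ↦ ?_
      rw [norm_mul, Real.norm_of_nonneg measureReal_nonneg, Real.norm_of_nonneg (le_max_right _ _)]
      refine mul_le_mul_of_nonneg_left (max_le ?_ ?_) measureReal_nonneg
      · have := (abs_sub (W (t - A - s)) M).trans (add_le_add_left (hK (t - A - s)) _)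
        linarith
      · exact add_nonneg ((abs_nonneg _).trans (hK 0)) (abs_nonneg _)
    · filter_upwards [ae_restrict_mem measurableSet_Ioi] with s hs
      refine tendsto_const_nhds.congr' ?_
      filter_upwards [hnear (A + s) (by linarith [Set.mem_Ioi.1 hs])] with t ht
      rw [← sub_sub] at ht
      rw [max_eq_right (by linarith), mul_zero]
  have h3 : ∀ t, |(∫ s in Set.Ioi 0, ν.real (Set.Ioi s) * W (t - A - s)) - M * ∫ y, y ∂ν|
      ≤ (∫ s in Set.Ioi 0, ν.real (Set.Ioi s) * max (|W (t - A - s) - M| - 2 * ε) 0)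
        + 2 * ε * ∫ y, y ∂ν := by
    intro t
    rw [← integral_tail hν hint, ← integral_const_mul, ← integral_const_mul,
      ← integral_sub (hGW _) (hGi.const_mul _)]
    have h4 : IntegrableOn (fun s ↦ ν.real (Set.Ioi s) * max (|W (t - A - s) - M| - 2 * ε) 0)
        (Set.Ioi 0) := by
      have := ((hGd (t - A)).sub (hGi.mul_const (2 * ε))).pos_part
      refine this.congr (.of_forall fun s ↦ ?_)
      simp only [Pi.sub_apply]
      rw [← mul_sub, mul_max_of_nonneg _ _ measureReal_nonneg, mul_zero]
    rw [← integral_add h4 (hGi.const_mul _)]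
    refine (abs_integral_le_integral_abs).trans (integral_mono_of_nonneg
      (.of_forall fun s ↦ abs_nonneg _) (h4.add (hGi.const_mul _)) (.of_forall fun s ↦ ?_))
    have : ν.real (Set.Ioi s) * W (t - A - s) - M * ν.real (Set.Ioi s)
      = ν.real (Set.Ioi s) * (W (t - A - s) - M) := by ring
    beta_reduce
    rw [this, abs_mul, abs_of_nonneg measureReal_nonneg, mul_comm (2 * ε), ← mul_add]
    refine mul_le_mul_of_nonneg_left ?_ measureReal_nonneg
    linarith [le_max_left (|W (t - A - s) - M| - 2 * ε) 0]
  have h5 := le_of_tendsto_of_tendsto ((h1.sub_const (M * ∫ y, y ∂ν)).abs)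
    (h2.add_const (2 * ε * ∫ y, y ∂ν)) (.of_forall h3)
  simpa using h5

/-- The limsup is a cluster point of `W` at infinity, so `atTop ⊓ comap W (𝓝 M)` is a nontrivial
filter along which `W` tends to it. -/
theorem limsup_mul_mean_eq (hWu : UniformContinuous W) (hK : ∀ t, |W t| ≤ K)
    (ha : ∀ t < a, W t = 0) (hren : ∀ t, W t = h t + ∫ y, W (t - y) ∂ν)
    (hν : ∀ᵐ y ∂ν, 0 ≤ y) (hint : Integrable (fun y ↦ y) ν) (hna : Nonarithmetic ν)
    (hh : Tendsto h atTop (𝓝 0)) {H : ℝ}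
    (hH : Tendsto (fun τ ↦ ∫ u in Set.Iic τ, h u) atTop (𝓝 H)) :
    H = limsup W atTop * ∫ y, y ∂ν := by
  have hb : IsBoundedUnder (· ≤ ·) atTop W := isBoundedUnder_of ⟨K, fun t ↦ (abs_le.1 (hK t)).2⟩
  have hb' : IsBoundedUnder (· ≥ ·) atTop W :=
    isBoundedUnder_of ⟨-K, fun t ↦ (abs_le.1 (hK t)).1⟩
  set M := limsup W atTop
  have hup : ∀ ε > 0, ∀ᶠ t in atTop, W t < M + ε := fun ε hε ↦
    eventually_lt_of_limsup_lt (lt_add_of_pos_right M hε) hb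
  have hne : (atTop ⊓ comap W (𝓝 M)).NeBot := by
    rw [neBot_inf_comap_iff_map, inf_comm]
    change MapClusterPt M atTop W
    rw [mapClusterPt_iff_frequently]
    intro s hs
    obtain ⟨ε, hε, hs⟩ := Metric.mem_nhds_iff.1 hs
    have h1 : ∃ᶠ t in atTop, M - ε < W t :=
      frequently_lt_of_lt_limsup hb'.isCoboundedUnder_le (sub_lt_self M hε)
    refine (h1.and_eventually (hup ε hε)).mono fun t ht ↦ hs ?_
    rw [Metric.mem_ball, Real.dist_eq, abs_lt]
    constructor <;> linarith [ht.1, ht.2]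
  exact eq_mul_mean_of_tendsto hWu hK ha hren hν hint hna hh hH
    (fun ε hε ↦ (hup ε hε).mono fun _ ↦ le_of_lt) (l := atTop ⊓ comap W (𝓝 M)) inf_le_left
    (tendsto_comap.mono_left inf_le_right)

/-- The key renewal theorem for uniformly continuous solutions of the renewal equation. -/
theorem tendsto_of_renewal_equation (hWu : UniformContinuous W) (hK : ∀ t, |W t| ≤ K)
    (ha : ∀ t < a, W t = 0) (hren : ∀ t, W t = h t + ∫ y, W (t - y) ∂ν)
    (hν : ∀ᵐ y ∂ν, 0 ≤ y) (hint : Integrable (fun y ↦ y) ν) (hpos : 0 < ∫ y, y ∂ν)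
    (hna : Nonarithmetic ν) (hh : Tendsto h atTop (𝓝 0)) {H : ℝ}
    (hH : Tendsto (fun τ ↦ ∫ u in Set.Iic τ, h u) atTop (𝓝 H)) :
    Tendsto W atTop (𝓝 (H / ∫ y, y ∂ν)) := by
  have hb : IsBoundedUnder (· ≤ ·) atTop W := isBoundedUnder_of ⟨K, fun t ↦ (abs_le.1 (hK t)).2⟩
  have hb' : IsBoundedUnder (· ≤ ·) atTop (fun t ↦ -W t) :=
    isBoundedUnder_of ⟨K, fun t ↦ (neg_le_of_abs_le (hK t) |> neg_le.1 )⟩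
  have h1 := limsup_mul_mean_eq hWu hK ha hren hν hint hna hh hH
  have h2 := limsup_mul_mean_eq (W := fun t ↦ -W t) (h := fun t ↦ -h t) (H := -H) (K := K) (a := a)
    hWu.neg (fun t ↦ by rw [abs_neg]; exact hK t) (fun t ht ↦ by rw [ha t ht, neg_zero])
    (fun t ↦ by rw [integral_neg, hren t]; ring) hν hint hna (by simpa using hh.neg)
    (by simpa only [integral_neg] using hH.neg)
  rw [eq_comm, ← eq_div_iff hpos.ne'] at h1 h2
  rw [neg_div] at h2
  rw [Metric.tendsto_nhds]
  intro ε hε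
  filter_upwards [eventually_lt_of_limsup_lt (h1.trans_lt (lt_add_of_pos_right _ hε)) hb,
    eventually_lt_of_limsup_lt (h2.trans_lt (lt_add_of_pos_right _ hε)) hb'] with t ht ht'
  rw [Real.dist_eq, abs_lt]
  constructor <;> linarith

end KeyRenewal

end StatusUpdating

end

/-! ### The age of a renewal process and its renewal equation -/

noncomputable section

namespace StatusUpdating

theorem indepFun_of_disjoint {Ω ι β γ : Type*} {mΩ : MeasurableSpace Ω} {mβ : MeasurableSpace β}
    {mγ : MeasurableSpace γ} {P : Measure Ω} {σ : ι → MeasurableSpace Ω} (hle : ∀ i, σ i ≤ mΩ)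
    (h : iIndep σ P) {S T : Set ι} (hST : Disjoint S T) {f : Ω → β} {g : Ω → γ}
    (hf : Measurable[⨆ i ∈ S, σ i] f) (hg : Measurable[⨆ i ∈ T, σ i] g) : IndepFun f g P :=
  indep_of_indep_of_le_left
    (indep_of_indep_of_le_right (indep_iSup_of_disjoint hle h hST) hg.comap_le) hf.comap_le

theorem measurable_pi_of_forall {Ω κ : Type*} {m : MeasurableSpace Ω} {f : Ω → κ → ℝ}
    (h : ∀ k, Measurable fun ω ↦ f ω k) : Measurable f :=
  measurable_pi_iff.2 h

/-- Partial sums of a sequence of inter-update times. -/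
def partialSum (x : ℕ → ℝ) (n : ℕ) : ℝ := ∑ k ∈ Finset.range n, x k

@[fun_prop]
theorem measurable_partialSum (n : ℕ) : Measurable fun x ↦ partialSum x n :=
  Finset.measurable_fun_sum _ fun k _ ↦ measurable_pi_apply k

theorem partialSum_zero (x : ℕ → ℝ) : partialSum x 0 = 0 := by simp [partialSum]

theorem partialSum_one (x : ℕ → ℝ) : partialSum x 1 = x 0 := by simp [partialSum]

theorem partialSum_add (x : ℕ → ℝ) (m n : ℕ) :
    partialSum x (m + n) = partialSum x m + partialSum (fun k ↦ x (m + k)) n :=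
  Finset.sum_range_add _ _ _

theorem partialSum_mono {x : ℕ → ℝ} (hx : ∀ k, 0 ≤ x k) : Monotone (partialSum x) := fun _ _ h ↦
  Finset.sum_le_sum_of_subset_of_nonneg (Finset.range_mono h) fun k _ _ ↦ hx k

theorem partialSum_nonneg {x : ℕ → ℝ} (hx : ∀ k, 0 ≤ x k) (n : ℕ) : 0 ≤ partialSum x n :=
  Finset.sum_nonneg fun k _ ↦ hx k

/-- The pairs of a sequence of inter-update times and a time `t`, such that the age at time `t`
is larger than `v`. -/
def ageSet (v : ℝ) : Set ((ℕ → ℝ) × ℝ) :=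
  {z | ∃ l, partialSum z.1 l + v < z.2 ∧ z.2 < partialSum z.1 (l + 1)}

theorem measurableSet_ageSet (v : ℝ) : MeasurableSet (ageSet v) := by
  have : ageSet v = ⋃ l, {z | partialSum z.1 l + v < z.2 ∧ z.2 < partialSum z.1 (l + 1)} := by
    ext; simp [ageSet]
  rw [this]
  refine MeasurableSet.iUnion fun l ↦ (measurableSet_lt ?_ measurable_snd).inter
    (measurableSet_lt measurable_snd ?_)
  · exact ((measurable_partialSum l).comp measurable_fst).add_const v
  · exact (measurable_partialSum (l + 1)).comp measurable_fst

/-- The law of an i.i.d. sequence with marginal `ν`. -/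
abbrev iidLaw (ν : Measure ℝ) : Measure (ℕ → ℝ) := Measure.infinitePi fun _ ↦ ν

/-- The probability that the age at time `t` is larger than `v`. -/
def ageTail (ν : Measure ℝ) (v t : ℝ) : ℝ := (iidLaw ν).real {x | (x, t) ∈ ageSet v}

/-- The contribution of the first inter-update interval to `ageTail`. -/
def firstTail (ν : Measure ℝ) (v t : ℝ) : ℝ := (Set.Ioi v).indicator (fun t ↦ ν.real (Set.Ioi t)) t

variable {ν : Measure ℝ} {v : ℝ}

theorem ageTail_nonneg (t : ℝ) : 0 ≤ ageTail ν v t := measureReal_nonneg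

theorem firstTail_nonneg (t : ℝ) : 0 ≤ firstTail ν v t :=
  Set.indicator_nonneg (fun _ _ ↦ measureReal_nonneg) _

theorem firstTail_le (t : ℝ) : firstTail ν v t ≤ ν.real (Set.Ioi t) :=
  Set.indicator_le_self' (fun _ _ ↦ measureReal_nonneg) _

variable [IsProbabilityMeasure ν]

theorem ae_iidLaw_nonneg (hν : ∀ᵐ y ∂ν, 0 ≤ y) : ∀ᵐ x ∂(iidLaw ν), ∀ k, 0 ≤ x k :=
  ae_all_iff.2 fun k ↦
    (measurePreserving_eval_infinitePi (fun _ : ℕ ↦ ν) k).quasiMeasurePreserving.ae hν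

theorem map_iidLaw_shift : (iidLaw ν).map (fun x k ↦ x (k + 1)) = iidLaw ν := by
  have hi : iIndepFun (fun (k : ℕ) (x : ℕ → ℝ) ↦ x k) (iidLaw ν) :=
    iIndepFun_infinitePi (X := fun _ x ↦ x) fun _ ↦ measurable_id
  have := (hi.precomp (add_left_injective 1)).map_fun_eq_infinitePi_map (by fun_prop)
  refine this.trans (congrArg _ (funext fun k ↦ ?_))
  exact (measurePreserving_eval_infinitePi (fun _ : ℕ ↦ ν) (k + 1)).map_eq

theorem map_iidLaw_head_shift :
    (iidLaw ν).map (fun x ↦ (x 0, fun k ↦ x (k + 1))) = ν.prod (iidLaw ν) := by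
  have hi : iIndepFun (fun (k : ℕ) (x : ℕ → ℝ) ↦ x k) (iidLaw ν) :=
    iIndepFun_infinitePi (X := fun _ x ↦ x) fun _ ↦ measurable_id
  have hle : ∀ k : ℕ, MeasurableSpace.comap (fun x : ℕ → ℝ ↦ x k) inferInstance
      ≤ (inferInstance : MeasurableSpace (ℕ → ℝ)) := fun k ↦ (measurable_pi_apply k).comap_le
  have hind : IndepFun (fun x : ℕ → ℝ ↦ x 0) (fun x k ↦ x (k + 1)) (iidLaw ν) := by
    refine indepFun_of_disjoint hle hi.iIndep (S := {0}) (T := Set.Ici 1) (by simp) ?_ ?_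
    · exact (comap_measurable (fun x : ℕ → ℝ ↦ x 0)).mono
        (le_iSup₂_of_le 0 (by simp) le_rfl) le_rfl
    · refine measurable_pi_of_forall fun k ↦ ?_
      exact (comap_measurable (fun x : ℕ → ℝ ↦ x (k + 1))).mono
        (le_iSup₂_of_le (k + 1) (by simp) le_rfl) le_rfl
  have hm : Measurable fun (x : ℕ → ℝ) (k : ℕ) ↦ x (k + 1) := by fun_prop
  rw [(indepFun_iff_map_prod_eq_prod_map_map (measurable_pi_apply 0).aemeasurable
    hm.aemeasurable).1 hind,
    map_iidLaw_shift]
  congr 1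
  exact (measurePreserving_eval_infinitePi (fun _ : ℕ ↦ ν) 0).map_eq

theorem ageTail_le_one (t : ℝ) : ageTail ν v t ≤ 1 := measureReal_le_one

theorem abs_ageTail_le (t : ℝ) : |ageTail ν v t| ≤ 1 := by
  rw [abs_of_nonneg (ageTail_nonneg t)]
  exact ageTail_le_one t

@[fun_prop]
theorem measurable_ageTail : Measurable (ageTail ν v) :=
  (measurable_measure_prodMk_right (μ := iidLaw ν) (measurableSet_ageSet v)).ennreal_toReal

theorem ageTail_of_nonpos (hν : ∀ᵐ y ∂ν, 0 ≤ y) (hv : 0 ≤ v) {t : ℝ} (ht : t ≤ 0) :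
    ageTail ν v t = 0 := by
  refine (measureReal_eq_zero_iff).2 (measure_eq_zero_iff_ae_notMem.2 ?_)
  filter_upwards [ae_iidLaw_nonneg hν] with x hx
  rintro ⟨l, hl, -⟩
  have := partialSum_nonneg hx l
  dsimp only at hl
  linarith

/-- Split at the first renewal: either `t` falls in the first interval, or the process restarted
after it has the required age at `t - x 0`. -/
theorem mem_ageSet_iff {x : ℕ → ℝ} {t : ℝ} : (x, t) ∈ ageSet v ↔
    (v < t ∧ t < x 0) ∨ ((fun k ↦ x (k + 1)), t - x 0) ∈ ageSet v := by
  have h (l : ℕ) : partialSum x (l + 1) = x 0 + partialSum (fun k ↦ x (k + 1)) l := by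
    rw [add_comm l, partialSum_add, partialSum_one]
    simp only [add_comm 1]
  simp only [ageSet, Set.mem_ofPred_eq]
  rw [← Nat.or_exists_add_one]
  simp only [h, partialSum_zero, zero_add, add_zero]
  refine or_congr Iff.rfl (exists_congr fun l ↦ ?_)
  constructor <;> rintro ⟨h1, h2⟩ <;> constructor <;> linarith

theorem ageTail_eq (hν : ∀ᵐ y ∂ν, 0 ≤ y) (hv : 0 ≤ v) (t : ℝ) :
    ageTail ν v t = firstTail ν v t + ∫ y, ageTail ν v (t - y) ∂ν := by
  have hA : MeasurableSet {x : ℕ → ℝ | v < t ∧ t < x 0} :=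
    (MeasurableSet.const _).inter (measurableSet_lt measurable_const (measurable_pi_apply 0))
  have hpre : MeasurableSet {z : ℝ × (ℕ → ℝ) | (z.2, t - z.1) ∈ ageSet v} :=
    (measurable_snd.prodMk (measurable_const.sub measurable_fst)) (measurableSet_ageSet v)
  have hB : MeasurableSet {x : ℕ → ℝ | ((fun k ↦ x (k + 1)), t - x 0) ∈ ageSet v} :=
    (by fun_prop : Measurable fun x : ℕ → ℝ ↦ ((fun k ↦ x (k + 1)), t - x 0))
      (measurableSet_ageSet v)
  have hunion : {x : ℕ → ℝ | (x, t) ∈ ageSet v} = {x : ℕ → ℝ | v < t ∧ t < x 0} ∪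
      {x : ℕ → ℝ | ((fun k ↦ x (k + 1)), t - x 0) ∈ ageSet v} := by
    ext x; exact mem_ageSet_iff
  have hdisj : AEDisjoint (iidLaw ν) {x : ℕ → ℝ | v < t ∧ t < x 0}
      {x : ℕ → ℝ | ((fun k ↦ x (k + 1)), t - x 0) ∈ ageSet v} := by
    refine measure_eq_zero_iff_ae_notMem.2 ?_
    filter_upwards [ae_iidLaw_nonneg hν] with x hx
    rintro ⟨⟨-, h1⟩, l, h2, -⟩
    have := partialSum_nonneg (x := fun k ↦ x (k + 1)) (fun k ↦ hx (k + 1)) l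
    dsimp only at h2
    linarith
  have h1 : (iidLaw ν).real {x : ℕ → ℝ | v < t ∧ t < x 0} = firstTail ν v t := by
    by_cases hvt : v < t
    · have : {x : ℕ → ℝ | v < t ∧ t < x 0} = Function.eval 0 ⁻¹' Set.Ioi t := by
        ext; simp [hvt]
      rw [this, measureReal_def, (measurePreserving_eval_infinitePi (fun _ : ℕ ↦ ν)
        0).measure_preimage measurableSet_Ioi.nullMeasurableSet, firstTail,
        Set.indicator_of_mem (Set.mem_Ioi.2 hvt), measureReal_def]
    · simp [hvt, firstTail]
  have h2 : (iidLaw ν).real {x : ℕ → ℝ | ((fun k ↦ x (k + 1)), t - x 0) ∈ ageSet v}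
      = ∫ y, ageTail ν v (t - y) ∂ν := by
    have h3 : {x : ℕ → ℝ | ((fun k ↦ x (k + 1)), t - x 0) ∈ ageSet v}
        = (fun x : ℕ → ℝ ↦ (x 0, fun k ↦ x (k + 1))) ⁻¹'
          {z : ℝ × (ℕ → ℝ) | (z.2, t - z.1) ∈ ageSet v} := rfl
    rw [h3, measureReal_def, ← Measure.map_apply (by fun_prop) hpre, map_iidLaw_head_shift,
      Measure.prod_apply hpre, ← integral_toReal (measurable_measure_prodMk_left hpre).aemeasurable
        (.of_forall fun _ ↦ measure_lt_top _ _)]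
    rfl
  rw [ageTail, hunion, measureReal_union₀ hB.nullMeasurableSet hdisj, h1, h2]

theorem tendsto_tail (ν : Measure ℝ) [IsProbabilityMeasure ν] :
    Tendsto (fun t ↦ ν.real (Set.Ioi t)) atTop (𝓝 0) := by
  have h1 : ∀ t, ν.real (Set.Ioi t) = 1 - cdf ν t := fun t ↦ by
    rw [cdf_eq_real, ← probReal_compl_eq_one_sub measurableSet_Iic, Set.compl_Iic]
  simp_rw [h1]
  simpa using (tendsto_cdf_atTop ν).const_sub 1

@[fun_prop]
theorem measurable_firstTail : Measurable (firstTail ν v) :=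
  Measurable.indicator (Antitone.measurable
    fun _ _ hst ↦ measureReal_mono (Set.Ioi_subset_Ioi hst)) measurableSet_Ioi

theorem integrable_firstTail (hν : ∀ᵐ y ∂ν, 0 ≤ y) (hint : Integrable (fun y ↦ y) ν) (hv : 0 ≤ v) :
    Integrable (firstTail ν v) :=
  (integrable_indicator_iff measurableSet_Ioi).2
    ((integrableOn_tail hν hint).mono_set (Set.Ioi_subset_Ioi hv))

theorem integral_firstTail (hν : ∀ᵐ y ∂ν, 0 ≤ y) (hint : Integrable (fun y ↦ y) ν)
    (hpos : 0 < ∫ y, y ∂ν) (hv : 0 ≤ v) :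
    ∫ t, firstTail ν v t = (∫ y, y ∂ν) * equilibriumTail ν v := by
  have h1 : ∫ t, firstTail ν v t = ∫ t in Set.Ioi v, ν.real (Set.Ioi t) :=
    integral_indicator measurableSet_Ioi
  have hG := integrableOn_tail hν hint
  have h2 : ∫ t in Set.Ioi 0, ν.real (Set.Ioi t)
      = (∫ t in Set.Ioc 0 v, ν.real (Set.Ioi t)) + ∫ t in Set.Ioi v, ν.real (Set.Ioi t) := by
    rw [← setIntegral_union Set.Ioc_disjoint_Ioi_same measurableSet_Ioi
      (hG.mono_set Set.Ioc_subset_Ioi_self) (hG.mono_set (Set.Ioi_subset_Ioi hv)),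
      Set.Ioc_union_Ioi_eq_Ioi hv]
  rw [integral_tail hν hint] at h2
  rw [h1, equilibriumTail, equilibriumCDF, mul_sub, ← mul_assoc, mul_inv_cancel₀ hpos.ne']
  linarith

theorem abs_intervalIntegral_ageTail_le (s t : ℝ) : |∫ u in s..t, ageTail ν v u| ≤ |t - s| := by
  simpa using intervalIntegral.norm_integral_le_of_norm_le_const (a := s) (b := t) (C := 1)
    (f := ageTail ν v) fun x _ ↦ abs_ageTail_le x

theorem intervalIntegrable_ageTail (s t : ℝ) : IntervalIntegrable (ageTail ν v) volume s t :=
  (intervalIntegrable_const (c := (1 : ℝ))).mono_fun measurable_ageTail.aestronglyMeasurable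
    (.of_forall fun u ↦ by simpa using abs_ageTail_le u)

/-- The age distribution, averaged over a short time interval, converges. -/
theorem tendsto_average_ageTail (hν : ∀ᵐ y ∂ν, 0 ≤ y) (hint : Integrable (fun y ↦ y) ν)
    (hpos : 0 < ∫ y, y ∂ν) (hna : Nonarithmetic ν) (hv : 0 ≤ v) {δ : ℝ} (hδ : 0 < δ) :
    Tendsto (fun t ↦ ∫ u in t..(t + δ), ageTail ν v u) atTop (𝓝 (δ * equilibriumTail ν v)) := by
  have : IsFiniteMeasure (volume.restrict (Set.uIoc 0 δ)) := ⟨by simp [Set.uIoc]⟩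
  -- The age tail may jump in `t` if `ν` has atoms. Its window integral is Lipschitz and solves the
  -- averaged renewal equation.
  set W : ℝ → ℝ := fun t ↦ ∫ u in t..(t + δ), ageTail ν v u with hW
  set h : ℝ → ℝ := fun t ↦ ∫ r in (0)..δ, firstTail ν v (t + r) with hh
  have hWdef (t : ℝ) : W t = ∫ r in (0)..δ, ageTail ν v (t + r) := by
    rw [intervalIntegral.integral_comp_add_left (ageTail ν v) t, add_zero]
  have hWu : UniformContinuous W := by
    refine LipschitzWith.uniformContinuous (K := 2) (LipschitzWith.of_dist_le_mul fun s t ↦ ?_)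
    -- Two windows differ by two end pieces of length `|t - s|`, hence the constant 2.
    have : W s - W t = (∫ u in s..t, ageTail ν v u) - ∫ u in (s + δ)..(t + δ), ageTail ν v u := by
      have h1 := intervalIntegral.integral_add_adjacent_intervals
        (intervalIntegrable_ageTail (ν := ν) (v := v) s t)
        (intervalIntegrable_ageTail t (t + δ))
      have h2 := intervalIntegral.integral_add_adjacent_intervals
        (intervalIntegrable_ageTail (ν := ν) (v := v) s (s + δ))
        (intervalIntegrable_ageTail (s + δ) (t + δ))
      simp only [hW]
      linarith
    rw [Real.dist_eq, this, Real.dist_eq]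
    refine (abs_sub _ _).trans ((add_le_add (abs_intervalIntegral_ageTail_le s t)
      (abs_intervalIntegral_ageTail_le _ _)).trans (le_of_eq ?_))
    rw [add_sub_add_right_eq_sub, abs_sub_comm t s]
    push_cast
    ring
  have hWK (t : ℝ) : |W t| ≤ δ := by
    simpa [abs_of_pos hδ] using abs_intervalIntegral_ageTail_le (ν := ν) (v := v) t (t + δ)
  have hW0 : ∀ t < -δ, W t = 0 := fun t ht ↦ by
    rw [hWdef, intervalIntegral.integral_of_le hδ.le]
    refine setIntegral_eq_zero_of_forall_eq_zero fun r hr ↦ ?_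
    exact ageTail_of_nonpos hν hv (by linarith [hr.2])
  have hfi : Integrable (firstTail ν v) := integrable_firstTail hν hint hv
  have hren (t : ℝ) : W t = h t + ∫ y, W (t - y) ∂ν := by
    have hI : Integrable (Function.uncurry fun r y ↦ ageTail ν v (t + r - y))
        ((volume.restrict (Set.uIoc 0 δ)).prod ν) :=
      .of_bound (measurable_ageTail.comp (by fun_prop)).aestronglyMeasurable 1
        (.of_forall fun z ↦ abs_ageTail_le _)
    have h1 : ∫ y, W (t - y) ∂ν = ∫ r in (0)..δ, ∫ y, ageTail ν v (t + r - y) ∂ν := by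
      rw [intervalIntegral_integral_swap hI]
      simp_rw [hWdef, sub_add_eq_add_sub]
    rw [h1, hh, ← intervalIntegral.integral_add]
    · rw [hWdef]
      congr with r
      exact ageTail_eq hν hv _
    · exact (hfi.comp_add_left t).intervalIntegrable
    · have := hI.integral_prod_left
      rw [Set.uIoc_of_le hδ.le] at this
      exact (intervalIntegrable_iff_integrableOn_Ioc_of_le hδ.le).2 this
  have hh0 : Tendsto h atTop (𝓝 0) := by
    have : Tendsto (fun t ↦ ν.real (Set.Ioi t) * δ) atTop (𝓝 0) := by
      simpa using (tendsto_tail ν).mul_const δ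
    refine squeeze_zero_norm (fun t ↦ ?_) this
    have h1 := intervalIntegral.norm_integral_le_of_norm_le_const (a := 0) (b := δ)
      (C := ν.real (Set.Ioi t)) (f := fun r ↦ firstTail ν v (t + r)) fun r hr ↦ by
        rw [Set.uIoc_of_le hδ.le] at hr
        rw [Real.norm_of_nonneg (firstTail_nonneg _)]
        exact (firstTail_le _).trans
          (measureReal_mono (Set.Ioi_subset_Ioi (by linarith [hr.1])))
    rwa [sub_zero, abs_of_pos hδ] at h1
  have hH : Tendsto (fun τ ↦ ∫ t in Set.Iic τ, h t) atTop
      (𝓝 (δ * ((∫ y, y ∂ν) * equilibriumTail ν v))) := by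
    rw [← integral_firstTail hν hint hpos hv]
    have hI : Integrable (Function.uncurry fun r t ↦ firstTail ν v (t + r))
        ((volume.restrict (Set.uIoc 0 δ)).prod volume) := by
      refine (integrable_prod_iff (measurable_firstTail.comp
        (by fun_prop)).aestronglyMeasurable).2 ⟨.of_forall fun r ↦ hfi.comp_add_right r, ?_⟩
      change Integrable (fun r ↦ ∫ t, ‖firstTail ν v (t + r)‖) _
      simp_rw [integral_add_right_eq_self (fun t ↦ ‖firstTail ν v t‖)]
      exact integrable_const _
    have h1 : ∫ t, h t = δ * ∫ t, firstTail ν v t := by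
      rw [hh, ← intervalIntegral_integral_swap hI]
      simp_rw [integral_add_right_eq_self (firstTail ν v)]
      simp
    have h2 : Integrable h := by
      have := hI.integral_prod_right
      rw [Set.uIoc_of_le hδ.le] at this
      simpa only [hh, intervalIntegral.integral_of_le hδ.le, Function.uncurry_apply_pair] using this
    rw [← h1]
    exact (aecover_Iic tendsto_id).integral_tendsto_of_countably_generated h2
  have := tendsto_of_renewal_equation hWu hWK hW0 hren hν hint hpos hna hh0 hH
  convert this using 2
  field_simp

end StatusUpdating

end

/-! ### Limits of the age tail and of the status of one source -/

noncomputable section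

namespace StatusUpdating

section AgeLimit

variable {ν : Measure ℝ} [IsProbabilityMeasure ν] {v : ℝ}

/-- An age above `v + δ` at time `s` means that the same interval already covered `t ≥ s - δ`, with
age above `v`. -/
theorem ageTail_add_le {δ s t : ℝ} (hts : t ≤ s) (hst : s ≤ t + δ) :
    ageTail ν (v + δ) s ≤ ageTail ν v t := by
  refine measureReal_mono fun x ↦ ?_
  rintro ⟨l, h1, h2⟩
  exact ⟨l, by dsimp only at *; linarith, by dsimp only at *; linarith⟩

theorem continuous_equilibriumTail : Continuous (equilibriumTail ν) := by
  have h1 : Continuous fun x ↦ ∫ s in (0)..x, ν.real (Set.Ioi s) :=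
    intervalIntegral.continuous_primitive (fun a b ↦ Antitone.intervalIntegrable
      fun _ _ hst ↦ measureReal_mono (Set.Ioi_subset_Ioi hst)) 0
  have h2 : equilibriumTail ν
      = fun x ↦ 1 - (∫ y, y ∂ν)⁻¹ * ∫ s in (0)..(max x 0), ν.real (Set.Ioi s) := by
    funext x
    rw [equilibriumTail, equilibriumCDF, intervalIntegral.integral_of_le (le_max_right _ _)]
    rcases le_total 0 x with h | h
    · rw [max_eq_left h]
    · rw [max_eq_right h, Set.Ioc_eq_empty (not_lt.2 h), Set.Ioc_self]
  rw [h2]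
  exact continuous_const.sub (continuous_const.mul (h1.comp (continuous_id.max continuous_const)))

/-- The age of a renewal process with nonarithmetic inter-renewal law converges in distribution to
the equilibrium distribution. -/
theorem tendsto_ageTail (hν : ∀ᵐ y ∂ν, 0 ≤ y) (hint : Integrable (fun y ↦ y) ν)
    (hpos : 0 < ∫ y, y ∂ν) (hna : Nonarithmetic ν) (hv : 0 < v) :
    Tendsto (ageTail ν v) atTop (𝓝 (equilibriumTail ν v)) := by
  rw [Metric.tendsto_nhds]
  intro ε hε
  obtain ⟨δ₀, hδ₀, hcont⟩ := Metric.continuousAt_iff.1 (continuous_equilibriumTail (ν := ν)).continuousAt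
    (ε / 2) (half_pos hε)
  obtain ⟨δ, hδ, hδ1⟩ := exists_between (lt_min hδ₀ hv)
  obtain ⟨hδδ₀, hδv⟩ := lt_min_iff.1 hδ1
  have hc1 : dist (equilibriumTail ν (v + δ)) (equilibriumTail ν v) < ε / 2 :=
    hcont (by rw [Real.dist_eq]; simpa [abs_of_pos hδ])
  have hc2 : dist (equilibriumTail ν (v - δ)) (equilibriumTail ν v) < ε / 2 :=
    hcont (by rw [Real.dist_eq]; simpa [abs_of_pos hδ])
  rw [Real.dist_eq, abs_lt] at hc1 hc2
  have hl1 := tendsto_average_ageTail hν hint hpos hna (v := v + δ) (by linarith) hδ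
  have hl2 := (tendsto_average_ageTail hν hint hpos hna (v := v - δ) (by linarith) hδ).comp
    (tendsto_atTop_add_const_right _ (-δ) tendsto_id)
  have hδε : 0 < δ * (ε / 2) := by positivity
  -- `δ * ageTail ν v t` lies between the window integral after `t` at level `v + δ` and the one
  -- before `t` at level `v - δ`.
  filter_upwards [hl1.eventually (lt_mem_nhds (sub_lt_self _ hδε)),
    hl2.eventually (gt_mem_nhds (lt_add_of_pos_right _ hδε))] with t h1 h2
  simp only [Function.comp_apply, id] at h2
  have h3 : ∫ u in t..(t + δ), ageTail ν (v + δ) u ≤ δ * ageTail ν v t := by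
    have := intervalIntegral.integral_mono_on (μ := volume) (by linarith : t ≤ t + δ)
      (intervalIntegrable_ageTail t (t + δ)) (intervalIntegrable_const (c := ageTail ν v t))
      fun u hu ↦ ageTail_add_le hu.1 hu.2
    simpa using this
  have h4 : δ * ageTail ν v t ≤ ∫ u in (t + -δ)..(t + -δ + δ), ageTail ν (v - δ) u := by
    have := intervalIntegral.integral_mono_on (μ := volume) (by linarith : t + -δ ≤ t + -δ + δ)
      (intervalIntegrable_const (c := ageTail ν v t)) (intervalIntegrable_ageTail _ _)
      fun u hu ↦ by
        have := ageTail_add_le (ν := ν) (v := v - δ) (δ := δ) (s := t) (t := u)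
          (by linarith [hu.2]) (by linarith [hu.1])
        rwa [sub_add_cancel] at this
    simpa using this
  rw [Real.dist_eq, abs_lt]
  constructor
  · refine lt_of_mul_lt_mul_left (a := δ) ?_ hδ.le
    nlinarith
  · refine lt_of_mul_lt_mul_left (a := δ) ?_ hδ.le
    nlinarith

end AgeLimit

/-- The triples of a sequence of inter-update times, a sequence of sizes and a time `r`, such that
the age at time `r` is larger than the transmission time of the current update. -/
def updatedSet (c : ℝ) : Set (((ℕ → ℝ) × (ℕ → ℝ)) × ℝ) :=
  {z | ∃ l, partialSum z.1.1 l ≤ z.2 ∧ z.2 < partialSum z.1.1 (l + 1) ∧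
    z.1.2 l / c < z.2 - partialSum z.1.1 l}

theorem measurableSet_updatedSet (c : ℝ) : MeasurableSet (updatedSet c) := by
  have : updatedSet c = ⋃ l, {z | partialSum z.1.1 l ≤ z.2 ∧ z.2 < partialSum z.1.1 (l + 1) ∧
      z.1.2 l / c < z.2 - partialSum z.1.1 l} := by
    ext; simp [updatedSet]
  rw [this]
  have hS (l : ℕ) : Measurable fun z : ((ℕ → ℝ) × (ℕ → ℝ)) × ℝ ↦ partialSum z.1.1 l :=
    (measurable_partialSum l).comp (measurable_fst.comp measurable_fst)
  have hlt (l : ℕ) : MeasurableSet {z : ((ℕ → ℝ) × (ℕ → ℝ)) × ℝ |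
      z.1.2 l / c < z.2 - partialSum z.1.1 l} :=
    measurableSet_lt (by fun_prop) (measurable_snd.sub (hS l))
  exact MeasurableSet.iUnion fun l ↦ (measurableSet_le (hS l) measurable_snd).inter
    ((measurableSet_lt measurable_snd (hS (l + 1))).inter (hlt l))

/-- The probability that a source with inter-update law `ν`, size law `η` and capacity `c`
is up to date at time `r`, when an update of size distributed as `η` is generated at time `0`. -/
def updatedProb (ν η : Measure ℝ) (c r : ℝ) : ℝ :=
  ((iidLaw ν).prod (iidLaw η)).real {z | (z, r) ∈ updatedSet c}

section UpdatedLimit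

variable {ν η : Measure ℝ} [IsProbabilityMeasure ν] [IsProbabilityMeasure η] {c : ℝ}

theorem abs_updatedProb_le (r : ℝ) : |updatedProb ν η c r| ≤ 1 := by
  rw [updatedProb, abs_of_nonneg measureReal_nonneg]
  exact measureReal_le_one

theorem measurable_updatedProb : Measurable (updatedProb ν η c) :=
  (measurable_measure_prodMk_right (μ := (iidLaw ν).prod (iidLaw η))
    (measurableSet_updatedSet c)).ennreal_toReal

theorem measurableSet_ageSet_div (r : ℝ) :
    MeasurableSet {z : (ℕ → ℝ) × ℝ | (z.1, r) ∈ ageSet (z.2 / c)} := by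
  have : {z : (ℕ → ℝ) × ℝ | (z.1, r) ∈ ageSet (z.2 / c)}
      = ⋃ l, {z | partialSum z.1 l + z.2 / c < r ∧ r < partialSum z.1 (l + 1)} := by
    ext; simp [ageSet]
  rw [this]
  have hS (l : ℕ) : Measurable fun z : (ℕ → ℝ) × ℝ ↦ partialSum z.1 l :=
    (measurable_partialSum l).comp measurable_fst
  have hlt (l : ℕ) : MeasurableSet {z : (ℕ → ℝ) × ℝ | partialSum z.1 l + z.2 / c < r} :=
    measurableSet_lt ((hS l).add (measurable_snd.div_const c)) measurable_const
  exact MeasurableSet.iUnion fun l ↦ (hlt l).inter (measurableSet_lt measurable_const (hS (l + 1)))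

theorem eq_of_partialSum_le_lt {x : ℕ → ℝ} (hx : ∀ k, 0 ≤ x k) {r : ℝ} {k l : ℕ}
    (hk : partialSum x k ≤ r) (hk' : r < partialSum x (k + 1))
    (hl : partialSum x l ≤ r) (hl' : r < partialSum x (l + 1)) : k = l := by
  have key {a b : ℕ} (ha : partialSum x a ≤ r) (hb : r < partialSum x (b + 1)) : a ≤ b := by
    by_contra! h
    exact absurd (partialSum_mono hx (Nat.succ_le_of_lt h)) (not_le.2 (ha.trans_lt hb))
  exact le_antisymm (key hk hl') (key hl hk')

/-- Once the inter-update times are fixed, so is the index of the current update, and the size with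
that index has law `η`. The whole sequence of sizes can thus be replaced by one variable. -/
theorem measure_slice_eq (hc : 0 < c) (hη : ∀ᵐ y ∂η, 0 < y) {x : ℕ → ℝ} (hx : ∀ k, 0 ≤ x k)
    (r : ℝ) :
    iidLaw η {y | ((x, y), r) ∈ updatedSet c} = η {u | (x, r) ∈ ageSet (u / c)} := by
  -- For `u > 0` the bound `partialSum x l ≤ r` is implied by the age condition; positivity of sizes
  -- enters here.
  have hage {u : ℝ} (hu : 0 < u) : (x, r) ∈ ageSet (u / c) ↔
      ∃ l, partialSum x l ≤ r ∧ r < partialSum x (l + 1) ∧ u / c < r - partialSum x l := by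
    have : 0 < u / c := div_pos hu hc
    refine exists_congr fun l ↦ ?_
    dsimp only
    constructor
    · rintro ⟨h1, h2⟩
      exact ⟨by linarith, h2, by linarith⟩
    · rintro ⟨-, h2, h3⟩
      exact ⟨by linarith, h2⟩
  by_cases h : ∃ l, partialSum x l ≤ r ∧ r < partialSum x (l + 1)
  · obtain ⟨l, hl, hl'⟩ := h
    have huniq (f : ℕ → ℝ) : (∃ k, partialSum x k ≤ r ∧ r < partialSum x (k + 1) ∧
        f k / c < r - partialSum x k) ↔ f l / c < r - partialSum x l := by
      constructor
      · rintro ⟨k, hk, hk', h⟩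
        rwa [eq_of_partialSum_le_lt hx hk hk' hl hl'] at h
      · exact fun h ↦ ⟨l, hl, hl', h⟩
    have h1 : {y : ℕ → ℝ | ((x, y), r) ∈ updatedSet c}
        = Function.eval l ⁻¹' {u | u / c < r - partialSum x l} := by
      ext y
      exact huniq y
    rw [h1, (measurePreserving_eval_infinitePi (fun _ : ℕ ↦ η) l).measure_preimage
      (measurableSet_lt (by fun_prop) measurable_const).nullMeasurableSet]
    refine measure_congr ?_
    filter_upwards [hη] with u hu
    exact propext ((hage hu).trans (huniq fun _ ↦ u)).symm
  · have h1 : {y : ℕ → ℝ | ((x, y), r) ∈ updatedSet c} = ∅ := by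
      ext y
      simp only [Set.mem_ofPred_eq, Set.mem_empty_iff_false, iff_false]
      rintro ⟨l, hl, hl', -⟩
      exact h ⟨l, hl, hl'⟩
    rw [h1, measure_empty, eq_comm, measure_eq_zero_iff_ae_notMem]
    filter_upwards [hη] with u hu hmem
    obtain ⟨l, hl, hl', -⟩ := (hage hu).1 hmem
    exact h ⟨l, hl, hl'⟩

theorem updatedProb_eq (hν : ∀ᵐ y ∂ν, 0 ≤ y) (hη : ∀ᵐ y ∂η, 0 < y) (hc : 0 < c) (r : ℝ) :
    updatedProb ν η c r = ∫ y, ageTail ν (y / c) r ∂η := by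
  have hm : MeasurableSet {z : (ℕ → ℝ) × (ℕ → ℝ) | (z, r) ∈ updatedSet c} :=
    measurable_prodMk_right (measurableSet_updatedSet c)
  have hm2 := measurableSet_ageSet_div (c := c) r
  have h1 : ((iidLaw ν).prod (iidLaw η)) {z | (z, r) ∈ updatedSet c}
      = ((iidLaw ν).prod η) {z | (z.1, r) ∈ ageSet (z.2 / c)} := by
    rw [Measure.prod_apply hm, Measure.prod_apply hm2]
    refine lintegral_congr_ae ?_
    filter_upwards [ae_iidLaw_nonneg hν] with x hx
    exact measure_slice_eq hc hη hx r
  rw [updatedProb, measureReal_def, h1, Measure.prod_apply_symm hm2,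
    ← integral_toReal (measurable_measure_prodMk_right hm2).aemeasurable
      (.of_forall fun _ ↦ measure_lt_top _ _)]
  rfl

theorem measurable_ageTail_div (r : ℝ) : Measurable fun y ↦ ageTail ν (y / c) r :=
  (measurable_measure_prodMk_right (μ := iidLaw ν)
    (measurableSet_ageSet_div (c := c) r)).ennreal_toReal

theorem tendsto_updatedProb (hν : ∀ᵐ y ∂ν, 0 ≤ y) (hint : Integrable (fun y ↦ y) ν)
    (hpos : 0 < ∫ y, y ∂ν) (hna : Nonarithmetic ν) (hη : ∀ᵐ y ∂η, 0 < y) (hc : 0 < c) :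
    Tendsto (updatedProb ν η c) atTop (𝓝 (∫ y, equilibriumTail ν (y / c) ∂η)) := by
  rw [funext (updatedProb_eq hν hη hc)]
  refine tendsto_integral_filter_of_dominated_convergence (fun _ ↦ 1)
    (.of_forall fun r ↦ (measurable_ageTail_div r).aestronglyMeasurable)
    (.of_forall fun r ↦ .of_forall fun y ↦ abs_ageTail_le r) (integrable_const _) ?_
  filter_upwards [hη] with y hy
  exact tendsto_ageTail hν hint hpos hna (div_pos hy hc)

end UpdatedLimit

end StatusUpdating

end

/-! ### Independence of past and future, and growth of the epochs -/

noncomputable section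

namespace StatusUpdating

section General

variable {Ω : Type*} [MeasurableSpace Ω] {P : Measure Ω} [IsProbabilityMeasure P]

/-- Freezing: integrate out a variable that is independent of an event and of a parameter. -/
theorem measureReal_inter_of_indepFun {β : Type*} [MeasurableSpace β] {A : Set Ω} {R : Ω → ℝ}
    {Z : Ω → β} (hind : IndepFun (fun ω ↦ (A.indicator (fun _ ↦ (1 : ℝ)) ω, R ω)) Z P)
    (hA : MeasurableSet A) (hR : Measurable R) (hZ : Measurable Z) {D : Set (β × ℝ)}
    (hD : MeasurableSet D) :
    P.real (A ∩ {ω | (Z ω, R ω) ∈ D}) = ∫ ω in A, (P.map Z).real {z | (z, R ω) ∈ D} ∂P := by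
  have hf : Measurable fun ω ↦ (A.indicator (fun _ ↦ (1 : ℝ)) ω, R ω) :=
    (measurable_const.indicator hA).prodMk hR
  -- The event `A` is encoded as its indicator being `1`, so that it becomes a coordinate of the
  -- random vector.
  set D' : Set ((ℝ × ℝ) × β) := {w | w.1.1 = 1 ∧ (w.2, w.1.2) ∈ D} with hD'
  have hDm : MeasurableSet D' :=
    (measurableSet_eq_fun (by fun_prop) measurable_const).inter
      ((by fun_prop : Measurable fun w : (ℝ × ℝ) × β ↦ (w.2, w.1.2)) hD)
  have h1 : A ∩ {ω | (Z ω, R ω) ∈ D}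
      = (fun ω ↦ ((A.indicator (fun _ ↦ (1 : ℝ)) ω, R ω), Z ω)) ⁻¹' D' := by
    ext ω
    by_cases hω : ω ∈ A <;> simp [hD', hω]
  have hslice : ∀ ω, (P.map Z) (Prod.mk (A.indicator (fun _ ↦ (1 : ℝ)) ω, R ω) ⁻¹' D')
      = A.indicator (fun ω ↦ (P.map Z) {z | (z, R ω) ∈ D}) ω := by
    intro ω
    by_cases hω : ω ∈ A
    · simp [hD', hω]
    · simp [hD', hω]
  have hms : Measurable fun ω ↦ (P.map Z) {z | (z, R ω) ∈ D} :=
    (measurable_measure_prodMk_right (μ := P.map Z) hD).comp hR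
  rw [measureReal_def, h1, ← Measure.map_apply (hf.prodMk hZ) hDm,
    (indepFun_iff_map_prod_eq_prod_map_map hf.aemeasurable hZ.aemeasurable).1 hind,
    Measure.prod_apply hDm, lintegral_map (measurable_measure_prodMk_left hDm) hf]
  simp_rw [hslice]
  rw [lintegral_indicator hA, ← integral_toReal hms.aemeasurable
    (.of_forall fun _ ↦ measure_lt_top _ _)]
  rfl

/-- Events that eventually coincide almost surely have the same limiting probability. -/
theorem tendsto_measureReal_sub {A B : ℝ → Set Ω} (hA : ∀ t, MeasurableSet (A t))
    (hB : ∀ t, MeasurableSet (B t)) (h : ∀ᵐ ω ∂P, ∀ᶠ t in atTop, (ω ∈ A t ↔ ω ∈ B t)) :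
    Tendsto (fun t ↦ P.real (A t) - P.real (B t)) atTop (𝓝 0) := by
  have hi {C : Set Ω} (hC : MeasurableSet C) : Integrable (C.indicator fun _ ↦ (1 : ℝ)) P :=
    (integrable_const _).indicator hC
  have h1 : ∀ t, P.real (A t) - P.real (B t)
      = ∫ ω, ((A t).indicator (fun _ ↦ (1 : ℝ)) ω - (B t).indicator (fun _ ↦ (1 : ℝ)) ω) ∂P :=
    fun t ↦ by
      rw [integral_sub (hi (hA t)) (hi (hB t)), integral_indicator_const _ (hA t),
        integral_indicator_const _ (hB t)]
      simp
  simp_rw [h1]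
  rw [← integral_zero Ω ℝ (μ := P)]
  refine tendsto_integral_filter_of_dominated_convergence (fun _ ↦ 1)
    (.of_forall fun t ↦ ((hi (hA t)).sub (hi (hB t))).1) (.of_forall fun t ↦ .of_forall fun ω ↦ ?_)
    (integrable_const _) ?_
  · by_cases h1 : ω ∈ A t <;> by_cases h2 : ω ∈ B t <;> simp [h1, h2]
  · filter_upwards [h] with ω hω
    refine tendsto_const_nhds.congr' ?_
    filter_upwards [hω] with t ht
    by_cases h1 : ω ∈ A t
    · simp [h1, ht.1 h1]
    · simp [h1, mt ht.2 h1]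

/-- If the partial sums grow at rate `μ`, the partial sum up to index `⌊a t⌋ + 1` grows at rate
`a μ`. -/
theorem tendsto_partialSum_floor_div {x : ℕ → ℝ} {μ a : ℝ} (ha : 0 < a)
    (h : Tendsto (fun n : ℕ ↦ partialSum x n / n) atTop (𝓝 μ)) :
    Tendsto (fun t : ℝ ↦ partialSum x (⌊a * t⌋₊ + 1) / t) atTop (𝓝 (a * μ)) := by
  have h1 : Tendsto (fun t : ℝ ↦ ⌊a * t⌋₊ + 1) atTop atTop :=
    (tendsto_add_atTop_nat 1).comp
      (tendsto_nat_floor_atTop.comp (tendsto_id.const_mul_atTop ha))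
  have h2 : Tendsto (fun t : ℝ ↦ ((⌊a * t⌋₊ + 1 : ℕ) : ℝ) / t) atTop (𝓝 a) := by
    have := (tendsto_nat_floor_mul_div_atTop ha.le).add tendsto_inv_atTop_zero
    rw [add_zero] at this
    refine this.congr fun t ↦ ?_
    push_cast
    ring
  refine (h2.mul (h.comp h1)).congr fun t ↦ ?_
  have : ((⌊a * t⌋₊ + 1 : ℕ) : ℝ) ≠ 0 := by positivity
  simp only [Function.comp_apply]
  field_simp

end General

variable {Ω : Type*} {m : ℕ}

/-- Source `i` is up to date at time `t`, and its last update is the `(l+1)`-st one for some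
`l ∈ I`. -/
def updatedIn (T : ℕ → Ω → Fin m → ℝ) (Y : Fin m → ℕ → Ω → ℝ) (c : Fin m → ℝ) (I : Set ℕ)
    (i : Fin m) (t : ℝ) : Set Ω :=
  {ω | ∃ l ∈ I, epoch T i (l + 1) ω ≤ t ∧ t < epoch T i (l + 2) ω ∧
    Y i l ω / c i < t - epoch T i (l + 1) ω}

/-- The standing assumptions on the inter-update times and the sizes. -/
structure IsModel [MeasurableSpace Ω] (P : Measure Ω) (T : ℕ → Ω → Fin m → ℝ)
    (Y : Fin m → ℕ → Ω → ℝ) : Prop where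
  measurable_T : ∀ n, Measurable (T n)
  measurable_Y : ∀ i j, Measurable (Y i j)
  indep : iIndep (generatedSigma T Y) P
  ident_T : ∀ n, IdentDistrib (T n) (T 0) P P
  ident_Y : ∀ i j, IdentDistrib (Y i j) (Y i 0) P P
  nonneg_T : ∀ i, ∀ᵐ ω ∂P, 0 ≤ T 0 ω i
  integrable_T : ∀ i, Integrable (fun ω ↦ T 0 ω i) P
  mean_pos : ∀ i, 0 < ∫ ω, T 0 ω i ∂P
  nonarithmetic : ∀ i, Nonarithmetic (P.map fun ω ↦ T 0 ω i)
  pos_Y : ∀ i, ∀ᵐ ω ∂P, 0 < Y i 0 ω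

variable {T : ℕ → Ω → Fin m → ℝ} {Y : Fin m → ℕ → Ω → ℝ} {c : Fin m → ℝ}

theorem measurable_epoch {mΩ : MeasurableSpace Ω} {i : Fin m} {n : ℕ}
    (h : ∀ k < n, Measurable fun ω ↦ T k ω i) : Measurable (epoch T i n) :=
  Finset.measurable_fun_sum _ fun k hk ↦ h k (Finset.mem_range.1 hk)

theorem measurableSet_updatedIn {mΩ : MeasurableSpace Ω} {i : Fin m} {I : Set ℕ}
    (hT : ∀ l ∈ I, ∀ k < l + 2, Measurable fun ω ↦ T k ω i) (hY : ∀ l ∈ I, Measurable (Y i l))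
    (t : ℝ) : MeasurableSet (updatedIn T Y c I i t) := by
  have : updatedIn T Y c I i t = ⋃ l ∈ I, {ω | epoch T i (l + 1) ω ≤ t ∧ t < epoch T i (l + 2) ω ∧
      Y i l ω / c i < t - epoch T i (l + 1) ω} := by
    ext; simp only [updatedIn, Set.mem_iUnion, Set.mem_ofPred_eq, exists_prop]
  rw [this]
  refine MeasurableSet.biUnion I.to_countable fun l hl ↦ ?_
  have h1 : Measurable (epoch T i (l + 1)) := measurable_epoch fun k hk ↦ hT l hl k (by omega)
  have h2 : Measurable (epoch T i (l + 2)) := measurable_epoch (hT l hl)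
  have h3 : MeasurableSet {ω | Y i l ω / c i < t - epoch T i (l + 1) ω} :=
    measurableSet_lt ((hY l hl).div_const _) (measurable_const.sub h1)
  exact (measurableSet_le h1 measurable_const).inter
    ((measurableSet_lt measurable_const h2).inter h3)

/-- Restart at epoch `N + 1`: the update there has size `Y i N`, and the next inter-update time is
`T (N + 1)`. Neither belongs to the past defined below. -/
theorem mem_updatedIn_Ici_iff {i : Fin m} {N : ℕ} {t : ℝ} {ω : Ω} :
    ω ∈ updatedIn T Y c (Set.Ici N) i t ↔
      (((fun k ↦ T (N + 1 + k) ω i), (fun k ↦ Y i (N + k) ω)), t - epoch T i (N + 1) ω)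
        ∈ updatedSet (c i) := by
  have hS (l : ℕ) : epoch T i (N + 1 + l) ω
      = epoch T i (N + 1) ω + partialSum (fun k ↦ T (N + 1 + k) ω i) l :=
    partialSum_add (fun k ↦ T k ω i) (N + 1) l
  constructor
  · rintro ⟨l, hl, h1, h2, h3⟩
    obtain ⟨l, rfl⟩ := Nat.exists_eq_add_of_le (Set.mem_Ici.1 hl)
    rw [show N + l + 1 = N + 1 + l by ring, hS] at h1 h3
    rw [show N + l + 2 = N + 1 + (l + 1) by ring, hS] at h2
    refine ⟨l, ?_, ?_, ?_⟩ <;> dsimp only <;> linarith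
  · rintro ⟨l, h1, h2, h3⟩
    dsimp only at h1 h2 h3
    refine ⟨N + l, Nat.le_add_right _ _, ?_, ?_, ?_⟩
    · rw [show N + l + 1 = N + 1 + l by ring, hS]; linarith
    · rw [show N + l + 2 = N + 1 + (l + 1) by ring, hS]; linarith
    · rw [show N + l + 1 = N + 1 + l by ring, hS]; linarith

/-- The indices of the inter-update vectors `T 0, …, T N` and of the sizes `Y i 0, …, Y i (N - 1)`. -/
def pastIndices (m N : ℕ) : Set (ℕ ⊕ (Fin m × ℕ)) := {x | Sum.elim (· < N + 1) (·.2 < N) x}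

/-- The σ-algebra generated by the variables with indices in `pastIndices m N`. -/
@[reducible] def past (T : ℕ → Ω → Fin m → ℝ) (Y : Fin m → ℕ → Ω → ℝ) (N : ℕ) :
    MeasurableSpace Ω :=
  ⨆ x ∈ pastIndices m N, generatedSigma T Y x

theorem measurable_T_iSup (I : Set (ℕ ⊕ (Fin m × ℕ))) {k : ℕ} (hk : Sum.inl k ∈ I) (i : Fin m) :
    Measurable[⨆ x ∈ I, generatedSigma T Y x] fun ω ↦ T k ω i :=
  ((measurable_pi_apply i).comp (comap_measurable (T k))).mono
    (le_iSup₂_of_le (f := fun x _ ↦ generatedSigma T Y x) _ hk le_rfl) le_rfl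

theorem measurable_Y_iSup (I : Set (ℕ ⊕ (Fin m × ℕ))) {k : ℕ} {i : Fin m}
    (hk : Sum.inr (i, k) ∈ I) : Measurable[⨆ x ∈ I, generatedSigma T Y x] (Y i k) :=
  (comap_measurable (Y i k)).mono
    (le_iSup₂_of_le (f := fun x _ ↦ generatedSigma T Y x) _ hk le_rfl) le_rfl

/-- A last update with index `l < N` is recognised from `T 0, …, T (l + 1)` and `Y i l`, and `l + 1
≤ N`. -/
theorem measurableSet_past_updatedIn (N : ℕ) (i : Fin m) (t : ℝ) :
    MeasurableSet[past T Y N] (updatedIn T Y c (Set.Iio N) i t) := by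
  refine measurableSet_updatedIn (mΩ := past T Y N) (fun l hl k hk ↦ ?_) (fun l hl ↦ ?_) t
  · refine measurable_T_iSup _ ?_ i
    have := Set.mem_Iio.1 hl
    change k < N + 1
    omega
  · exact measurable_Y_iSup _ hl

end StatusUpdating

end

/-! ### Asymptotic decoupling and the limit for the system -/

noncomputable section

namespace StatusUpdating

variable {Ω : Type*} {m : ℕ}
variable {T : ℕ → Ω → Fin m → ℝ} {Y : Fin m → ℕ → Ω → ℝ} {c : Fin m → ℝ}

namespace IsModel

variable [MeasurableSpace Ω] {P : Measure Ω}

theorem measurable_T_apply (h : IsModel P T Y) (n : ℕ) (i : Fin m) :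
    Measurable fun ω ↦ T n ω i :=
  (measurable_pi_apply i).comp (h.measurable_T n)

theorem generatedSigma_le (h : IsModel P T Y) (x : ℕ ⊕ (Fin m × ℕ)) :
    generatedSigma T Y x ≤ ‹MeasurableSpace Ω› := by
  rcases x with n | p
  · exact (h.measurable_T n).comap_le
  · exact (h.measurable_Y p.1 p.2).comap_le

theorem past_le (h : IsModel P T Y) (N : ℕ) : past T Y N ≤ ‹MeasurableSpace Ω› :=
  iSup₂_le fun x _ ↦ h.generatedSigma_le x

theorem ident_T_apply (h : IsModel P T Y) (n : ℕ) (i : Fin m) :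
    IdentDistrib (fun ω ↦ T n ω i) (fun ω ↦ T 0 ω i) P P :=
  (h.ident_T n).comp (measurable_pi_apply i)

theorem iIndepFun_T (h : IsModel P T Y) (i : Fin m) : iIndepFun (fun n ω ↦ T n ω i) P := by
  have h1 : iIndepFun T P := h.indep.precomp Sum.inl_injective
  exact h1.comp (fun _ x ↦ x i) fun _ ↦ measurable_pi_apply i

theorem iIndepFun_Y (h : IsModel P T Y) (i : Fin m) : iIndepFun (Y i) P :=
  h.indep.precomp (g := fun k : ℕ ↦ Sum.inr (i, k)) fun a b hab ↦ by simpa using hab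

theorem measurable_shift (h : IsModel P T Y) (N : ℕ) (i : Fin m) :
    Measurable fun ω ↦ ((fun k ↦ T (N + 1 + k) ω i), (fun k ↦ Y i (N + k) ω)) :=
  (measurable_pi_iff.2 fun k ↦ h.measurable_T_apply (N + 1 + k) i).prodMk
    (measurable_pi_iff.2 fun k ↦ h.measurable_Y i (N + k))

theorem ae_nonneg (h : IsModel P T Y) : ∀ᵐ ω ∂P, ∀ i k, 0 ≤ T k ω i :=
  ae_all_iff.2 fun i ↦ ae_all_iff.2 fun k ↦
    (h.ident_T_apply k i).symm.ae_snd (p := fun x ↦ 0 ≤ x) measurableSet_Ici (h.nonneg_T i)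

theorem ae_tendsto_epoch_div (h : IsModel P T Y) : ∀ᵐ ω ∂P, ∀ i,
    Tendsto (fun n : ℕ ↦ epoch T i n ω / n) atTop (𝓝 (∫ ω, T 0 ω i ∂P)) :=
  ae_all_iff.2 fun i ↦ strong_law_ae_real (fun n ω ↦ T n ω i) (h.integrable_T i)
    (fun _ _ hkl ↦ (h.iIndepFun_T i).indepFun hkl) fun n ↦ h.ident_T_apply n i

theorem measurableSet_updatedIn (h : IsModel P T Y) (I : Set ℕ) (i : Fin m) (t : ℝ) :
    MeasurableSet (updatedIn T Y c I i t) :=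
  StatusUpdating.measurableSet_updatedIn (fun _ _ k _ ↦ h.measurable_T_apply k i)
    (fun l _ ↦ h.measurable_Y i l) t

variable [IsProbabilityMeasure P]

/-- Only one source is involved, so dependence between the coordinates of a vector `T n` is
invisible: its times and sizes are two independent i.i.d. sequences. -/
theorem map_shift (h : IsModel P T Y) (N : ℕ) (i : Fin m) :
    P.map (fun ω ↦ ((fun k ↦ T (N + 1 + k) ω i), (fun k ↦ Y i (N + k) ω)))
      = (iidLaw (P.map fun ω ↦ T 0 ω i)).prod (iidLaw (P.map (Y i 0))) := by
  have hT : P.map (fun ω k ↦ T (N + 1 + k) ω i) = iidLaw (P.map fun ω ↦ T 0 ω i) := by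
    rw [((h.iIndepFun_T i).precomp (add_right_injective (N + 1))).map_fun_eq_infinitePi_map
      fun k ↦ h.measurable_T_apply _ i]
    exact congrArg _ (funext fun k ↦ (h.ident_T_apply _ i).map_eq)
  have hY : P.map (fun ω k ↦ Y i (N + k) ω) = iidLaw (P.map (Y i 0)) := by
    rw [((h.iIndepFun_Y i).precomp (add_right_injective N)).map_fun_eq_infinitePi_map
      fun k ↦ h.measurable_Y i _]
    exact congrArg _ (funext fun k ↦ (h.ident_Y i _).map_eq)
  have hind : IndepFun (fun ω k ↦ T (N + 1 + k) ω i) (fun ω k ↦ Y i (N + k) ω) P := by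
    refine indepFun_of_disjoint h.generatedSigma_le h.indep (S := Set.range Sum.inl)
      (T := Set.range Sum.inr) Set.isCompl_range_inl_range_inr.disjoint
      (measurable_pi_of_forall fun k ↦ measurable_T_iSup _ (Set.mem_range_self _) i)
      (measurable_pi_of_forall fun k ↦ measurable_Y_iSup _ (Set.mem_range_self _))
  rw [(indepFun_iff_map_prod_eq_prod_map_map
    (measurable_pi_iff.2 fun k ↦ h.measurable_T_apply _ i).aemeasurable
    (measurable_pi_iff.2 fun k ↦ h.measurable_Y i _).aemeasurable).1 hind, hT, hY]

/-- Conditionally on the past, source `i` restarts afresh. -/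
theorem measureReal_inter_updatedIn_Ici (h : IsModel P T Y) (N : ℕ) (i : Fin m) {A : Set Ω}
    (hA : MeasurableSet[past T Y N] A) (t : ℝ) :
    P.real (A ∩ updatedIn T Y c (Set.Ici N) i t)
      = ∫ ω in A, updatedProb (P.map fun ω ↦ T 0 ω i) (P.map (Y i 0)) (c i)
        (t - epoch T i (N + 1) ω) ∂P := by
  have hep : Measurable[past T Y N] fun ω ↦ t - epoch T i (N + 1) ω := by
    have : Measurable[past T Y N] (epoch T i (N + 1)) :=
      measurable_epoch (mΩ := past T Y N) fun k hk ↦ measurable_T_iSup _ hk i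
    exact this.const_sub t
  have hpast : Measurable[past T Y N]
      fun ω ↦ (A.indicator (fun _ ↦ (1 : ℝ)) ω, t - epoch T i (N + 1) ω) :=
    (measurable_const.indicator hA).prodMk hep
  have hfut : Measurable[⨆ x ∈ (pastIndices m N)ᶜ, generatedSigma T Y x]
      fun ω ↦ ((fun k ↦ T (N + 1 + k) ω i), (fun k ↦ Y i (N + k) ω)) := by
    refine (measurable_pi_of_forall fun k ↦ measurable_T_iSup _ ?_ i).prodMk
      (measurable_pi_of_forall fun k ↦ measurable_Y_iSup _ ?_)
    · change ¬ N + 1 + k < N + 1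
      omega
    · change ¬ N + k < N
      omega
  have hind := indepFun_of_disjoint h.generatedSigma_le h.indep disjoint_compl_right hpast hfut
  have := measureReal_inter_of_indepFun hind (h.past_le N _ hA) (hep.mono (h.past_le N) le_rfl)
    (h.measurable_shift N i) (measurableSet_updatedSet (c i))
  rw [h.map_shift] at this
  rw [show updatedIn T Y c (Set.Ici N) i t = {ω | (((fun k ↦ T (N + 1 + k) ω i),
    (fun k ↦ Y i (N + k) ω)), t - epoch T i (N + 1) ω) ∈ updatedSet (c i)} from
    Set.ext fun ω ↦ mem_updatedIn_Ici_iff, this]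
  rfl

theorem tendsto_updatedProb (h : IsModel P T Y) (hc : ∀ i, 0 < c i) (i : Fin m) :
    Tendsto (updatedProb (P.map fun ω ↦ T 0 ω i) (P.map (Y i 0)) (c i)) atTop
      (𝓝 (∫ ω, equilibriumTail (P.map fun ω ↦ T 0 ω i) (Y i 0 ω / c i) ∂P)) := by
  have hTm := h.measurable_T_apply 0 i
  have hYm := h.measurable_Y i 0
  have := Measure.isProbabilityMeasure_map (μ := P) hTm.aemeasurable
  have := Measure.isProbabilityMeasure_map (μ := P) hYm.aemeasurable
  have hmean : ∫ y, y ∂(P.map fun ω ↦ T 0 ω i) = ∫ ω, T 0 ω i ∂P :=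
    integral_map hTm.aemeasurable aestronglyMeasurable_id
  have hlim := StatusUpdating.tendsto_updatedProb (ν := P.map fun ω ↦ T 0 ω i)
    (η := P.map (Y i 0)) ((ae_map_iff hTm.aemeasurable measurableSet_Ici).2 (h.nonneg_T i))
    ((integrable_map_measure aestronglyMeasurable_id hTm.aemeasurable).2 (h.integrable_T i))
    (hmean ▸ h.mean_pos i) (h.nonarithmetic i)
    ((ae_map_iff hYm.aemeasurable measurableSet_Ioi).2 (h.pos_Y i)) (hc i)
  have hcont : Continuous fun y ↦ equilibriumTail (P.map fun ω ↦ T 0 ω i) (y / c i) :=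
    continuous_equilibriumTail.comp (continuous_id.div_const _)
  rwa [integral_map hYm.aemeasurable hcont.aestronglyMeasurable] at hlim

/-- The sources with larger mean inter-update times are determined by the past, up to which
the source `j` has had fewer updates, so that source `j` decouples asymptotically. -/
theorem tendsto_updatedIn_insert (h : IsModel P T Y) (hc : ∀ i, 0 < c i) {s : Finset (Fin m)}
    {j : Fin m} (hj : ∀ i ∈ s, ∫ ω, T 0 ω j ∂P < ∫ ω, T 0 ω i ∂P) {L : ℝ}
    (hs : Tendsto (fun t ↦ P.real (⋂ i ∈ s, updatedIn T Y c Set.univ i t)) atTop (𝓝 L)) :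
    Tendsto (fun t ↦ P.real (updatedIn T Y c Set.univ j t ∩
      ⋂ i ∈ s, updatedIn T Y c Set.univ i t)) atTop
      (𝓝 ((∫ ω, equilibriumTail (P.map fun ω ↦ T 0 ω j) (Y j 0 ω / c j) ∂P) * L)) := by
  -- Any `a` slightly below `1 / μ_j` works, as `s` is finite and its means are strictly larger.
  obtain ⟨a, ha0, haj, has⟩ : ∃ a : ℝ, 0 < a ∧ a * ∫ ω, T 0 ω j ∂P < 1 ∧
      ∀ i ∈ s, 1 < a * ∫ ω, T 0 ω i ∂P := by
    have hj0 := h.mean_pos j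
    have h1 : ∀ᶠ a in 𝓝[<] (∫ ω, T 0 ω j ∂P)⁻¹, 0 < a :=
      nhdsWithin_le_nhds (lt_mem_nhds (inv_pos.2 hj0))
    have h2 : ∀ᶠ a in 𝓝[<] (∫ ω, T 0 ω j ∂P)⁻¹, ∀ i ∈ s, 1 < a * ∫ ω, T 0 ω i ∂P := by
      refine (Filter.eventually_all_finset s).2 fun i hi ↦ ?_
      have : Tendsto (fun a ↦ a * ∫ ω, T 0 ω i ∂P) (𝓝 (∫ ω, T 0 ω j ∂P)⁻¹)
          (𝓝 ((∫ ω, T 0 ω j ∂P)⁻¹ * ∫ ω, T 0 ω i ∂P)) := tendsto_id.mul_const _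
      refine nhdsWithin_le_nhds (this.eventually (lt_mem_nhds ?_))
      rw [inv_mul_eq_div, one_lt_div hj0]
      exact hj i hi
    obtain ⟨a, ⟨h1, h2⟩, h3⟩ := ((h1.and h2).and self_mem_nhdsWithin).exists
    exact ⟨a, h1, by rwa [← lt_div_iff₀ hj0, one_div], h2⟩
  set N : ℝ → ℕ := fun t ↦ ⌊a * t⌋₊ with hN
  set π := ∫ ω, equilibriumTail (P.map fun ω ↦ T 0 ω j) (Y j 0 ω / c j) ∂P
  set A : ℝ → Set Ω := fun t ↦ ⋂ i ∈ s, updatedIn T Y c (Set.Iio (N t)) i t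
  set ψ := updatedProb (P.map fun ω ↦ T 0 ω j) (P.map (Y j 0)) (c j) with hψ
  have hrate : ∀ᵐ ω ∂P, ∀ i, Tendsto (fun t : ℝ ↦ epoch T i (N t + 1) ω / t) atTop
      (𝓝 (a * ∫ ω, T 0 ω i ∂P)) := by
    filter_upwards [h.ae_tendsto_epoch_div] with ω hω i
    exact tendsto_partialSum_floor_div (x := fun k ↦ T k ω i) ha0 (hω i)
  have hmono : ∀ᵐ ω ∂P, ∀ i, Monotone fun n ↦ epoch T i n ω := by
    filter_upwards [h.ae_nonneg] with ω hω i
    exact partialSum_mono (x := fun k ↦ T k ω i) (hω i)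
  -- For `i ∈ s` epoch `N t + 1` is eventually after `t`, so the last update has index below `N t`.
  have hearly : ∀ᵐ ω ∂P, ∀ i ∈ s, ∀ᶠ t in atTop, (ω ∈ updatedIn T Y c Set.univ i t ↔
      ω ∈ updatedIn T Y c (Set.Iio (N t)) i t) := by
    filter_upwards [hrate, hmono] with ω hω hm i hi
    filter_upwards [(hω i).eventually (lt_mem_nhds (has i hi)), eventually_gt_atTop 0] with t ht ht0
    rw [one_lt_div ht0] at ht
    constructor
    · rintro ⟨l, -, h1, h2⟩
      refine ⟨l, ?_, h1, h2⟩
      by_contra! hl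
      have h3 : N t + 1 ≤ l + 1 := by simpa using hl
      exact absurd (hm i h3) (not_le.2 (h1.trans_lt ht))
    · rintro ⟨l, -, h1⟩
      exact ⟨l, trivial, h1⟩
  -- For `j` epoch `N t + 1` is eventually before `t`; an index `l < N t` would put epoch `l + 2`
  -- before `t` as well.
  have hlate : ∀ᵐ ω ∂P, ∀ᶠ t in atTop, (ω ∈ updatedIn T Y c Set.univ j t ↔
      ω ∈ updatedIn T Y c (Set.Ici (N t)) j t) := by
    filter_upwards [hrate, hmono] with ω hω hm
    filter_upwards [(hω j).eventually (gt_mem_nhds haj), eventually_gt_atTop 0] with t ht ht0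
    rw [div_lt_one ht0] at ht
    constructor
    · rintro ⟨l, -, h1, h2, h3⟩
      refine ⟨l, ?_, h1, h2, h3⟩
      by_contra! hl
      have h3 : l + 2 ≤ N t + 1 := by
        have : l < N t := by simpa using hl
        omega
      exact absurd (hm j h3) (not_le.2 (ht.trans h2))
    · rintro ⟨l, -, h1⟩
      exact ⟨l, trivial, h1⟩
  have hremain : ∀ᵐ ω ∂P, Tendsto (fun t ↦ t - epoch T j (N t + 1) ω) atTop atTop := by
    filter_upwards [hrate] with ω hω
    -- The remaining time is `t` times a factor tending to `1 - a μ_j > 0`.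
    refine (Tendsto.atTop_mul_pos (sub_pos.2 haj) tendsto_id ((hω j).const_sub 1)).congr' ?_
    filter_upwards [eventually_gt_atTop 0] with t ht
    simp only [id]
    field_simp
  have hAm (t : ℝ) : MeasurableSet[past T Y (N t)] (A t) :=
    Finset.measurableSet_biInter s fun i _ ↦ measurableSet_past_updatedIn (N t) i t
  have hAm' (t : ℝ) : MeasurableSet (A t) := h.past_le _ _ (hAm t)
  have hIm (t : ℝ) : MeasurableSet (⋂ i ∈ s, updatedIn T Y c Set.univ i t) :=
    Finset.measurableSet_biInter s fun i _ ↦ h.measurableSet_updatedIn _ i t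
  have hAiff : ∀ᵐ ω ∂P, ∀ᶠ t in atTop, (ω ∈ ⋂ i ∈ s, updatedIn T Y c Set.univ i t ↔ ω ∈ A t) := by
    filter_upwards [hearly] with ω hω
    filter_upwards [(Filter.eventually_all_finset s).2 hω] with t ht
    simp only [A, Set.mem_iInter]
    exact forall₂_congr ht
  have h1 : Tendsto (fun t ↦ P.real (updatedIn T Y c Set.univ j t ∩
      ⋂ i ∈ s, updatedIn T Y c Set.univ i t)
      - P.real (A t ∩ updatedIn T Y c (Set.Ici (N t)) j t)) atTop (𝓝 0) := by
    refine tendsto_measureReal_sub (fun t ↦ (h.measurableSet_updatedIn _ j t).inter (hIm t))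
      (fun t ↦ (hAm' t).inter (h.measurableSet_updatedIn _ j t)) ?_
    filter_upwards [hAiff, hlate] with ω h1 h2
    filter_upwards [h1, h2] with t h1 h2
    rw [Set.mem_inter_iff, Set.mem_inter_iff, h1, h2, and_comm]
  have h2 := tendsto_measureReal_sub hAm' hIm (hAiff.mono fun ω hω ↦ hω.mono fun t ht ↦ ht.symm)
  have hTm := h.measurable_T_apply 0 j
  have hYm := h.measurable_Y j 0
  have := Measure.isProbabilityMeasure_map (μ := P) hTm.aemeasurable
  have := Measure.isProbabilityMeasure_map (μ := P) hYm.aemeasurable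
  have hψm (t : ℝ) : Measurable fun ω ↦ ψ (t - epoch T j (N t + 1) ω) :=
    measurable_updatedProb.comp
      ((measurable_epoch fun k _ ↦ h.measurable_T_apply k j).const_sub t)
  have hψi (t : ℝ) : Integrable (fun ω ↦ ψ (t - epoch T j (N t + 1) ω) - π) P :=
    (Integrable.of_bound (hψm t).aestronglyMeasurable 1
      (.of_forall fun ω ↦ abs_updatedProb_le _)).sub (integrable_const _)
  -- The difference is the integral over `A t` of `ψ - π`, at most its `L¹` norm, which vanishes
  -- because the remaining time diverges.
  have h3 : Tendsto (fun t ↦ P.real (A t ∩ updatedIn T Y c (Set.Ici (N t)) j t)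
      - π * P.real (A t)) atTop (𝓝 0) := by
    have hlim : Tendsto (fun t ↦ ∫ ω, |ψ (t - epoch T j (N t + 1) ω) - π| ∂P) atTop
        (𝓝 (∫ _, (0 : ℝ) ∂P)) := by
      refine tendsto_integral_filter_of_dominated_convergence (fun _ ↦ 1 + |π|)
        (.of_forall fun t ↦ (hψi t).abs.1) (.of_forall fun t ↦ .of_forall fun ω ↦ ?_)
        (integrable_const _) ?_
      · rw [Real.norm_eq_abs, abs_abs]
        exact (abs_sub _ _).trans (add_le_add_left (abs_updatedProb_le _) _)
      · filter_upwards [hremain] with ω hω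
        have := (((h.tendsto_updatedProb hc j).comp hω).sub_const π).abs
        rwa [sub_self, abs_zero] at this
    rw [integral_zero] at hlim
    refine squeeze_zero_norm (fun t ↦ ?_) hlim
    have : P.real (A t ∩ updatedIn T Y c (Set.Ici (N t)) j t) - π * P.real (A t)
        = ∫ ω in A t, (ψ (t - epoch T j (N t + 1) ω) - π) ∂P := by
      rw [h.measureReal_inter_updatedIn_Ici (N t) j (hAm t) t, integral_sub
        (Integrable.of_bound (hψm t).aestronglyMeasurable 1
          (.of_forall fun ω ↦ abs_updatedProb_le _)) (integrable_const _), setIntegral_const,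
        smul_eq_mul, mul_comm π]
    rw [this]
    exact (norm_integral_le_integral_norm _).trans
      (setIntegral_le_integral (hψi t).abs (.of_forall fun ω ↦ abs_nonneg _))
  have h4 := ((h1.add h3).add ((h2.add hs).const_mul π))
  simp only [zero_add] at h4
  exact h4.congr fun t ↦ by ring

theorem tendsto_updatedIn_univ (h : IsModel P T Y) (hc : ∀ i, 0 < c i)
    (hdist : ∀ i j, i ≠ j → ∫ ω, T 0 ω i ∂P ≠ ∫ ω, T 0 ω j ∂P) (s : Finset (Fin m)) :
    Tendsto (fun t ↦ P.real (⋂ i ∈ s, updatedIn T Y c Set.univ i t)) atTop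
      (𝓝 (∏ i ∈ s, ∫ ω, equilibriumTail (P.map fun ω ↦ T 0 ω i) (Y i 0 ω / c i) ∂P)) := by
  -- The inserted source has the smallest mean; distinctness makes the inequality strict.
  induction s using Finset.induction_on_min_value (fun i ↦ ∫ ω, T 0 ω i ∂P) with
  | empty => simp
  | insert j s hjs hj ih =>
    rw [Finset.prod_insert hjs]
    simp_rw [Finset.set_biInter_insert]
    exact h.tendsto_updatedIn_insert hc (fun i hi ↦ lt_of_le_of_ne (hj i hi)
      (hdist j i fun hji ↦ hjs (hji ▸ hi))) ih

end IsModel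

/-- Divergence of the epochs bounds the set in `count`; for an unbounded set `sSup` would take the
default value `0`. -/
theorem count_spec {i : Fin m} {t : ℝ} {ω : Ω} (hmono : Monotone fun n ↦ epoch T i n ω)
    (hlim : Tendsto (fun n ↦ epoch T i n ω) atTop atTop) (ht : 0 ≤ t) :
    epoch T i (count T i t ω) ω ≤ t ∧ t < epoch T i (count T i t ω + 1) ω := by
  obtain ⟨n₀, hn₀⟩ := (hlim.eventually_gt_atTop t).exists
  have hbdd : BddAbove {n : ℕ | epoch T i n ω ≤ t} := by
    refine ⟨n₀, fun n hn ↦ ?_⟩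
    by_contra! hlt
    exact absurd (hmono hlt.le) (not_le.2 (lt_of_le_of_lt hn hn₀))
  refine ⟨Nat.sSup_mem (s := {n : ℕ | epoch T i n ω ≤ t}) ⟨0, by simpa [epoch] using ht⟩ hbdd, ?_⟩
  by_contra! hle
  exact absurd (le_csSup hbdd hle) (Nat.not_succ_le_self _)

theorem sourceUpdated_iff {init : Fin m → ℝ → Set Ω} {i : Fin m} {t : ℝ} {ω : Ω}
    (hnonneg : ∀ k, 0 ≤ T k ω i) (hlim : Tendsto (fun n ↦ epoch T i n ω) atTop atTop)
    (ht : 0 ≤ t) :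
    SourceUpdated T Y c init i t ω ↔
      (t < T 0 ω i ∧ ω ∈ init i t) ∨ ω ∈ updatedIn T Y c Set.univ i t := by
  have hmono : Monotone fun n ↦ epoch T i n ω := partialSum_mono (x := fun k ↦ T k ω i) hnonneg
  obtain ⟨h1, h2⟩ := count_spec hmono hlim ht
  have huniq {l : ℕ} (hl : epoch T i l ω ≤ t) (hl' : t < epoch T i (l + 1) ω) :
      count T i t ω = l :=
    eq_of_partialSum_le_lt (x := fun k ↦ T k ω i) hnonneg h1 h2 hl hl'
  have hone : epoch T i 1 ω = T 0 ω i := by simp [epoch]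
  rcases hcount : count T i t ω with _ | n
  · rw [hcount, zero_add, hone] at h2
    have hnot : ω ∉ updatedIn T Y c Set.univ i t := by
      rintro ⟨l, -, hl, hl', -⟩
      exact absurd (hcount.symm.trans (huniq hl hl')) (Nat.succ_ne_zero l).symm
    simp [SourceUpdated, hcount, h2, hnot]
  · rw [hcount] at h1 h2
    have hnot : ¬ t < T 0 ω i := by
      rw [not_lt, ← hone]
      exact (hmono (Nat.succ_le_succ n.zero_le)).trans h1
    have hiff : ω ∈ updatedIn T Y c Set.univ i t ↔ Y i n ω / c i < t - epoch T i (n + 1) ω := by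
      constructor
      · rintro ⟨l, -, hl, hl', h⟩
        have : n = l := Nat.succ_injective (hcount.symm.trans (huniq hl hl'))
        rwa [this]
      · exact fun h ↦ ⟨n, trivial, h1, h2, h⟩
    simp [SourceUpdated, hcount, age, hnot, hiff]

theorem IsModel.tendsto_systemUpdated [MeasurableSpace Ω] {P : Measure Ω} [IsProbabilityMeasure P]
    (h : IsModel P T Y) (hc : ∀ i, 0 < c i)
    (hdist : ∀ i j, i ≠ j → ∫ ω, T 0 ω i ∂P ≠ ∫ ω, T 0 ω j ∂P) {init : Fin m → ℝ → Set Ω}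
    (hinit : ∀ i t, MeasurableSet (init i t)) :
    Tendsto (fun t ↦ P.real (systemUpdated T Y c init t)) atTop
      (𝓝 (∏ i, ∫ ω, equilibriumTail (P.map fun ω ↦ T 0 ω i) (Y i 0 ω / c i) ∂P)) := by
  have hlim : ∀ᵐ ω ∂P, ∀ i, Tendsto (fun n ↦ epoch T i n ω) atTop atTop := by
    filter_upwards [h.ae_tendsto_epoch_div] with ω hω i
    refine (Tendsto.pos_mul_atTop (h.mean_pos i) (hω i) tendsto_natCast_atTop_atTop).congr' ?_
    filter_upwards [eventually_ne_atTop 0] with n hn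
    field_simp
  set B : ℝ → Set Ω := fun t ↦
    ⋂ i, ({ω | t < T 0 ω i} ∩ init i t ∪ updatedIn T Y c Set.univ i t)
  have hBm (t : ℝ) : MeasurableSet (B t) := MeasurableSet.iInter fun i ↦
    ((measurableSet_lt measurable_const (h.measurable_T_apply 0 i)).inter (hinit i t)).union
      (h.measurableSet_updatedIn _ i t)
  have hIm (t : ℝ) : MeasurableSet (⋂ i ∈ Finset.univ, updatedIn T Y c Set.univ i t) :=
    Finset.measurableSet_biInter _ fun i _ ↦ h.measurableSet_updatedIn _ i t
  have h1 : ∀ t, 0 ≤ t → P.real (systemUpdated T Y c init t) = P.real (B t) := fun t ht ↦ by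
    refine measureReal_congr ?_
    filter_upwards [hlim, h.ae_nonneg] with ω hω hω'
    refine propext ?_
    change (∀ i, SourceUpdated T Y c init i t ω) ↔ ω ∈ B t
    rw [Set.mem_iInter]
    exact forall_congr' fun i ↦ sourceUpdated_iff (hω' i) (hω i) ht
  have h2 : Tendsto (fun t ↦ P.real (B t)
      - P.real (⋂ i ∈ Finset.univ, updatedIn T Y c Set.univ i t)) atTop (𝓝 0) := by
    refine tendsto_measureReal_sub hBm hIm (.of_forall fun ω ↦ ?_)
    -- Once `t` exceeds every first inter-update time, no initial event is in force.
    filter_upwards [eventually_all.2 fun i ↦ eventually_ge_atTop (T 0 ω i)] with t ht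
    simp [B, fun i ↦ not_lt.2 (ht i)]
  have h3 := h2.add (h.tendsto_updatedIn_univ hc hdist Finset.univ)
  simp only [sub_add_cancel, zero_add] at h3
  refine h3.congr' ?_
  filter_upwards [eventually_ge_atTop 0] with t ht
  exact (h1 t ht).symm

end StatusUpdating

end

theorem mainTheorem4 {Ω : Type*} [MeasurableSpace Ω] (P : Measure Ω) [IsProbabilityMeasure P]
    (m : ℕ) (T : ℕ → Ω → Fin m → ℝ) (Y : Fin m → ℕ → Ω → ℝ) (c : Fin m → ℝ)
    (init : Fin m → ℝ → Set Ω)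
    (hTmeas : ∀ n, Measurable (T n))
    (hYmeas : ∀ i j, Measurable (Y i j))
    (hinit : ∀ i t, MeasurableSet (init i t))
    (hindep : iIndep (StatusUpdating.generatedSigma T Y) P)
    (hTident : ∀ n, IdentDistrib (T n) (T 0) P P)
    (hYident : ∀ i j, IdentDistrib (Y i j) (Y i 0) P P)
    (hTnonneg : ∀ i, ∀ᵐ ω ∂P, 0 ≤ T 0 ω i)
    (hTint : ∀ i, Integrable (fun ω => T 0 ω i) P)
    (hTmean : ∀ i, 0 < ∫ ω, T 0 ω i ∂P)
    (hTnonarith : ∀ i, StatusUpdating.Nonarithmetic (P.map (fun ω => T 0 ω i)))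
    (hTdistinct : ∀ i j, i ≠ j → ∫ ω, T 0 ω i ∂P ≠ ∫ ω, T 0 ω j ∂P)
    (hYpos : ∀ i, ∀ᵐ ω ∂P, 0 < Y i 0 ω)
    (hc : ∀ i, 0 < c i) :
    Tendsto (fun t : ℝ => P.real (StatusUpdating.systemUpdated T Y c init t)) atTop
      (𝓝 (∏ i, ∫ ω, StatusUpdating.equilibriumTail (P.map (fun ω' => T 0 ω' i))
        (Y i 0 ω / c i) ∂P)) := by
  have h : StatusUpdating.IsModel P T Y :=
    ⟨hTmeas, hYmeas, hindep, hTident, hYident, hTnonneg, hTint, hTmean, hTnonarith, hYpos⟩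
  exact h.tendsto_systemUpdated hc hTdistinct hinit
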